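/- Let $(M^{4n},g_M,I_1,I_2,I_3)$ be a hyperk\"ahler manifold with K\"ahler forms $\sigma_i=g_M(I_i\cdot,\cdot)$, where $I_1I_2=I_3=-I_2I_1$ (and cyclically). Let $\gamma_1,\gamma_2,\gamma_3,\gamma_4$ be closed $2$-forms on $M$ with $[\gamma_i]\in H^2(M,2\pi\mathbb{Z})$ which are sections of the bundle $\mathfrak{sp}(n)\subset\Lambda^2(M)$, i.e. which are of type $(1,1)$ with respect to every almost complex structure $aI_1+bI_2+cI_3$, $(a,b,c)\in S^2$. Let $\pi:M^{4n+4}_{\nu_1,\nu_2,\nu_3,\nu_4}\to M$ be a principal $\mathbb{T}^4$-bundle determined by $[\gamma_1],\dots,[\gamma_4]$, that is, one carrying connection $1$-forms $\nu_1,\dots,\nu_4$ with $d\nu_i=\pi^*\gamma_i$ (the $\nu_i$ are $\mathbb{T}^4$-invariant and dual to the generators of the four circle factors, each of period $2\pi$). On $M^{4n+4}_{\nu_1,\nu_2,\nu_3,\nu_4}$ put $$\check g=\pi^*g_M+\nu_1^2+\nu_2^2+\nu_3^2+\nu_4^2,$$ $$\check\omega_1=\pi^*\sigma_1+\nu_1\wedge\nu_2+\nu_3\wedge\nu_4,\quad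 \check\omega_2=\pi^*\sigma_2+\nu_1\wedge\nu_3+\nu_4\wedge\nu_2,\quad \check\omega_3=\pi^*\sigma_3+\nu_1\wedge\nu_4+\nu_2\wedge\nu_3.$$ Then $\check g$ is a Riemannian metric, and there are integrable almost complex structures $\check I_1,\check I_2,\check I_3$ satisfying the quaternion relations, for which $\check g$ is hyper-Hermitian with $\check\omega_i=\check g(\check I_i\cdot,\cdot)$. Moreover, for every $(a,b,c)\in S^2$, the almost complex structure $a\check I_1+b\check I_2+c\check I_3$ is integrable, and $\check g$ is Hermitian with respect to it with fundamental form $\check\omega=a\check\omega_1+b\check\omega_2+c\check\omega_3$. This Hermitian manifold, of complex dimension $2n+2$, is balanced: $$d(\check\omega^{\,2n+1})=0 .$$ Here an almost complex structure is called integrable if the exterior derivative of every $(1,0)$-form has no $(0,2)$-part. -/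

import Mathlib

open scoped Manifold ContDiff Topology

noncomputable section

namespace BalancedTorusBundle

/-! ### Exterior algebra of a real topological vector space -/

section Wedge

variable {V : Type*} [AddCommGroup V] [Module ℝ V] [TopologicalSpace V]

/-- The wedge product of alternating forms: the sum over all `(k, l)`-shuffles, so that
`(α ∧ β)(v, w) = α v * β w - α w * β v` for covectors. -/
def wedge {k l : ℕ} (α : V [⋀^Fin k]→L[ℝ] ℝ) (β : V [⋀^Fin l]→L[ℝ] ℝ) :
    V [⋀^Fin (k + l)]→L[ℝ] ℝ where
  toMultilinearMap := (((LinearMap.mul' ℝ ℝ).compAlternatingMap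
    (α.toAlternatingMap.domCoprod β.toAlternatingMap)).domDomCongr
      finSumFinEquiv).toMultilinearMap
  map_eq_zero_of_eq' := (((LinearMap.mul' ℝ ℝ).compAlternatingMap
    (α.toAlternatingMap.domCoprod β.toAlternatingMap)).domDomCongr
      finSumFinEquiv).map_eq_zero_of_eq'
  cont := by
    have h : ∀ s : Equiv.Perm.ModSumCongr (Fin k) (Fin l), Continuous fun v : Fin (k + l) → V =>
        LinearMap.mul' ℝ ℝ (AlternatingMap.domCoprod.summand α.toAlternatingMap β.toAlternatingMap s
          (fun i => v (finSumFinEquiv i))) := by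
      intro s
      induction s using Quotient.inductionOn' with | _ s
      have h' : Continuous fun v : Fin (k + l) → V => ((Equiv.Perm.sign s : ℤ) : ℝ) *
          (α (fun i => v (finSumFinEquiv (s (Sum.inl i)))) *
            β (fun i => v (finSumFinEquiv (s (Sum.inr i))))) :=
        continuous_const.mul
          ((α.cont.comp (continuous_pi fun i => continuous_apply _)).mul
            (β.cont.comp (continuous_pi fun i => continuous_apply _)))
      refine h'.congr fun v => ?_
      rcases Int.units_eq_one_or (Equiv.Perm.sign s) with hs | hs <;>
        simp [AlternatingMap.domCoprod.summand_mk'', hs]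
    refine (continuous_finsetSum Finset.univ fun s _ => h s).congr fun v => ?_
    simp [AlternatingMap.domCoprod_apply, map_sum, Function.comp_def]

/-- The wedge power `θ ∧ ⋯ ∧ θ` (`k` factors) of a `2`-form. -/
def wedgePow (θ : V [⋀^Fin 2]→L[ℝ] ℝ) : (k : ℕ) → V [⋀^Fin (2 * k)]→L[ℝ] ℝ
  | 0 => ContinuousAlternatingMap.constOfIsEmpty ℝ V (Fin 0) 1
  | k + 1 => wedge (wedgePow θ k) θ

end Wedge

/-! ### Differential forms on manifolds

All manifolds are modelled on a real normed space `E` (without boundary). -/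

section Forms

variable {E : Type*} [NormedAddCommGroup E] [NormedSpace ℝ E]
  {E' : Type*} [NormedAddCommGroup E'] [NormedSpace ℝ E']
  {F : Type*} [NormedAddCommGroup F] [NormedSpace ℝ F]

/-- (Not necessarily smooth) `F`-valued differential `k`-forms on `M`. -/
abbrev DForm (E : Type*) [NormedAddCommGroup E] [NormedSpace ℝ E]
    (M : Type*) [TopologicalSpace M] [ChartedSpace E M] (k : ℕ)
    (F : Type*) [NormedAddCommGroup F] [NormedSpace ℝ F] : Type _ :=
  (x : M) → (TangentSpace 𝓘(ℝ, E) x) [⋀^Fin k]→L[ℝ] F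

variable {M : Type*} [TopologicalSpace M] [ChartedSpace E M]
  {M' : Type*} [TopologicalSpace M'] [ChartedSpace E' M']

/-- The pullback `f^* θ`. -/
def DForm.pullback {k : ℕ} (f : M → M') (θ : DForm E' M' k F) : DForm E M k F :=
  fun x => (θ (f x)).compContinuousLinearMap (mfderiv 𝓘(ℝ, E) 𝓘(ℝ, E') f x)

/-- The expression of a form in the preferred chart at `x`: a form on (an open subset of) `E`. -/
def DForm.inChart {k : ℕ} (θ : DForm E M k F) (x : M) : E → E [⋀^Fin k]→L[ℝ] F :=
  DForm.pullback (E := E) (M := E) (chartAt E x).symm θ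

/-- A form is smooth if all its expressions in charts are. -/
def DForm.IsSmooth {k : ℕ} (θ : DForm E M k F) : Prop :=
  ∀ x : M, ContDiffOn ℝ ∞ (θ.inChart x) (chartAt E x).target

/-- The exterior derivative, computed at `x` in the preferred chart at `x`. -/
def DForm.d {k : ℕ} (θ : DForm E M k F) : DForm E M (k + 1) F :=
  fun x => ContinuousAlternatingMap.compContinuousLinearMap
    (extDeriv (θ.inChart x) (chartAt E x x) : E [⋀^Fin (k + 1)]→L[ℝ] F)
    (mfderiv 𝓘(ℝ, E) 𝓘(ℝ, E) (chartAt E x) x)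

/-- The wedge product of differential forms. -/
def DForm.wedge {k l : ℕ} (α : DForm E M k ℝ) (β : DForm E M l ℝ) : DForm E M (k + l) ℝ :=
  fun x => BalancedTorusBundle.wedge (α x) (β x)

/-- The wedge power of a differential `2`-form. -/
def DForm.pow (θ : DForm E M 2 ℝ) (k : ℕ) : DForm E M (2 * k) ℝ :=
  fun x => BalancedTorusBundle.wedgePow (θ x) k

end Forms

/-! ### Hermitian structures -/

section Hermitian

variable {E : Type*} [NormedAddCommGroup E] [NormedSpace ℝ E]
  {M : Type*} [TopologicalSpace M] [ChartedSpace E M]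

/-- Fields of endomorphisms of the tangent spaces of `M`. -/
abbrev EndField (E : Type*) [NormedAddCommGroup E] [NormedSpace ℝ E]
    (M : Type*) [TopologicalSpace M] [ChartedSpace E M] : Type _ :=
  (x : M) → TangentSpace 𝓘(ℝ, E) x →L[ℝ] TangentSpace 𝓘(ℝ, E) x

/-- A smooth Riemannian metric on `M`. -/
abbrev Metric (E : Type*) [NormedAddCommGroup E] [NormedSpace ℝ E]
    (M : Type*) [TopologicalSpace M] [ChartedSpace E M] [IsManifold 𝓘(ℝ, E) ∞ M] : Type _ :=
  Bundle.ContMDiffRiemannianMetric 𝓘(ℝ, E) ∞ E (fun x : M => TangentSpace 𝓘(ℝ, E) x)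

/-- A complex-valued `1`-form is of type `(1,0)` for `J` if `α ∘ J = i α`. -/
def IsTypeOneZero (J : EndField E M) (α : DForm E M 1 ℂ) : Prop :=
  ∀ (x : M) (v : TangentSpace 𝓘(ℝ, E) x), α x ![J x v] = Complex.I * α x ![v]

/-- A complex-valued `2`-form lies in `Λ^{2,0} ⊕ Λ^{1,1}`, i.e. its `(0,2)`-part vanishes: its
complex-bilinear extension vanishes on all pairs of `(0,1)`-vectors `v + i J v`, `w + i J w`. -/
def HasNoZeroTwoPart (J : EndField E M) (β : DForm E M 2 ℂ) : Prop :=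
  ∀ (x : M) (v w : TangentSpace 𝓘(ℝ, E) x),
    β x ![v, w] - β x ![J x v, J x w]
      + Complex.I * (β x ![J x v, w] + β x ![v, J x w]) = 0

/-- Integrability of an almost complex structure: `d Γ(Λ^{1,0}) ⊆ Γ(Λ^{2,0} ⊕ Λ^{1,1})`. -/
def IsIntegrable (J : EndField E M) : Prop :=
  ∀ α : DForm E M 1 ℂ, α.IsSmooth → IsTypeOneZero J α → HasNoZeroTwoPart J α.d

variable [IsManifold 𝓘(ℝ, E) ∞ M]

/-- `(M, J)` is a complex manifold: `J` is a smooth integrable almost complex structure. -/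
structure IsComplexStructure (J : EndField E M) : Prop where
  smooth : ContMDiff 𝓘(ℝ, E) (𝓘(ℝ, E).prod 𝓘(ℝ, E →L[ℝ] E)) ∞
    (fun x : M => Bundle.TotalSpace.mk' (E →L[ℝ] E)
      (E := fun x : M => TangentSpace 𝓘(ℝ, E) x →L[ℝ] TangentSpace 𝓘(ℝ, E) x) x (J x))
  sq : ∀ (x : M) (v : TangentSpace 𝓘(ℝ, E) x), J x (J x v) = -v
  integrable : IsIntegrable J

/-- `(M, g, J, θ)` is a Hermitian manifold, with `θ = g(J·, ·)`. -/
structure IsHermitian (g : Metric E M) (J : EndField E M) (θ : DForm E M 2 ℝ) : Prop where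
  complex : IsComplexStructure J
  compatible : ∀ (x : M) (v w : TangentSpace 𝓘(ℝ, E) x),
    g.inner x (J x v) (J x w) = g.inner x v w
  fundamental : ∀ (x : M) (v w : TangentSpace 𝓘(ℝ, E) x), θ x ![v, w] = g.inner x (J x v) w

/-- `(M, g, J, θ)` is a balanced Hermitian manifold of complex dimension `m`:
it is Hermitian and `d (θ ^ (m - 1)) = 0`. -/
structure IsBalanced (m : ℕ) (g : Metric E M) (J : EndField E M) (θ : DForm E M 2 ℝ) :
    Prop where
  dim : Module.finrank ℝ E = 2 * m
  hermitian : IsHermitian g J θ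
  coclosed : (θ.pow (m - 1)).d = 0

/-- `(M, g, I₁, I₂, I₃)` is hyper-Hermitian with associated `2`-forms `θ₁, θ₂, θ₃`;
the indices `0, 1, 2` are taken modulo `3`. -/
structure IsHyperHermitian (g : Metric E M) (I : Fin 3 → EndField E M)
    (θ : Fin 3 → DForm E M 2 ℝ) : Prop where
  hermitian : ∀ i, IsHermitian g (I i) (θ i)
  mul_eq : ∀ (i : Fin 3) (x : M) (v : TangentSpace 𝓘(ℝ, E) x),
    I i x (I (i + 1) x v) = I (i + 2) x v
  anticomm : ∀ (i : Fin 3) (x : M) (v : TangentSpace 𝓘(ℝ, E) x),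
    I i x (I (i + 1) x v) = -(I (i + 1) x (I i x v))

/-- A hyperkähler structure: hyper-Hermitian with closed forms `σ₁, σ₂, σ₃`. -/
structure IsHyperKahler (g : Metric E M) (I : Fin 3 → EndField E M)
    (σ : Fin 3 → DForm E M 2 ℝ) : Prop where
  hyperHermitian : IsHyperHermitian g I σ
  closed : ∀ i, (σ i).d = 0

/-- The combination `a I₁ + b I₂ + c I₃`. -/
def combJ (I : Fin 3 → EndField E M) (a b c : ℝ) : EndField E M :=
  fun x => a • I 0 x + b • I 1 x + c • I 2 x

/-- The combination `a θ₁ + b θ₂ + c θ₃`. -/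
def combForm (θ : Fin 3 → DForm E M 2 ℝ) (a b c : ℝ) : DForm E M 2 ℝ :=
  fun x => a • θ 0 x + b • θ 1 x + c • θ 2 x

/-- The `2`-form `γ` is a section of the bundle `𝔰𝔭(n)`: it is of type `(1,1)` with respect to
every almost complex structure `a I₁ + b I₂ + c I₃` with `(a, b, c) ∈ S²`. -/
def IsSpForm (I : Fin 3 → EndField E M) (γ : DForm E M 2 ℝ) : Prop :=
  ∀ a b c : ℝ, a ^ 2 + b ^ 2 + c ^ 2 = 1 → ∀ (x : M) (v w : TangentSpace 𝓘(ℝ, E) x),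
    γ x ![combJ I a b c x v, combJ I a b c x w] = γ x ![v, w]

end Hermitian

/-! ### Principal bundles with torus fibre -/

section Bundle

/-- The torus `𝕋⁴ = (S¹)⁴`. -/
abbrev T4 : Type := Circle × Circle × Circle × Circle

/-- The model space of the Lie group `𝕋⁴`. -/
abbrev T4Model :=
  (𝓡 1).prod ((𝓡 1).prod ((𝓡 1).prod (𝓡 1)))

/-- The exponential map `(t₁, …, t₄) ↦ (e^{i t₁}, …, e^{i t₄})`. -/
def T4.exp (t : Fin 4 → ℝ) : T4 :=
  (Circle.exp (t 0), Circle.exp (t 1), Circle.exp (t 2), Circle.exp (t 3))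

variable {E : Type*} [NormedAddCommGroup E] [NormedSpace ℝ E]
  {E' : Type*} [NormedAddCommGroup E'] [NormedSpace ℝ E']
  {M : Type*} [TopologicalSpace M] [ChartedSpace E M]
  {P : Type*} [TopologicalSpace P] [ChartedSpace E' P]

/-- `π : P → M` is a smooth principal `𝕋⁴`-bundle: `𝕋⁴` acts smoothly on `P` along the fibres, and `M` is covered
by open sets `U` with equivariant diffeomorphisms `π⁻¹(U) ≅ U × 𝕋⁴` over `U`. -/
structure IsPrincipalT4Bundle [MulAction T4 P] (π : P → M) : Prop where
  smooth_proj : ContMDiff 𝓘(ℝ, E') 𝓘(ℝ, E) ∞ π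
  smooth_act : ContMDiff (T4Model.prod 𝓘(ℝ, E')) 𝓘(ℝ, E') ∞ (fun q : T4 × P => q.1 • q.2)
  proj_smul : ∀ (g : T4) (p : P), π (g • p) = π p
  locally_trivial : ∀ x : M, ∃ U : Set M, IsOpen U ∧ x ∈ U ∧
    ∃ e : OpenPartialHomeomorph P (M × T4),
      e.source = π ⁻¹' U ∧ e.target = U ×ˢ Set.univ ∧
      ContMDiffOn 𝓘(ℝ, E') (𝓘(ℝ, E).prod T4Model) ∞ e e.source ∧
      ContMDiffOn (𝓘(ℝ, E).prod T4Model) 𝓘(ℝ, E') ∞ e.symm e.target ∧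
      ∀ p ∈ e.source, (e p).1 = π p ∧ ∀ g : T4, e (g • p) = (π p, g * (e p).2)

/-- The fundamental vector field on `P` generated by the `j`-th circle factor of `𝕋⁴`. -/
def fundamentalField [MulAction T4 P] (j : Fin 4) (p : P) : TangentSpace 𝓘(ℝ, E') p :=
  (mfderiv 𝓘(ℝ, ℝ) 𝓘(ℝ, E') (fun t : ℝ => T4.exp (Pi.single j t) • p) 0 (1 : ℝ) :)

/-- `(ν₁, …, ν₄)` is a (principal) connection on the `𝕋⁴`-bundle `P`, given by its four
`𝕋⁴`-invariant connection `1`-forms. -/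
structure IsConnection [MulAction T4 P] (ν : Fin 4 → DForm E' P 1 ℝ) : Prop where
  smooth : ∀ i, (ν i).IsSmooth
  vertical : ∀ (i j : Fin 4) (p : P), ν i p ![fundamentalField j p] = if i = j then 1 else 0
  invariant : ∀ (i : Fin 4) (t : T4), DForm.pullback (fun p : P => t • p) (ν i) = ν i

/-- The forms
`ω̌₁ = σ₁ + ν₁ ∧ ν₂ + ν₃ ∧ ν₄`, `ω̌₂ = σ₂ + ν₁ ∧ ν₃ + ν₄ ∧ ν₂`, `ω̌₃ = σ₃ + ν₁ ∧ ν₄ + ν₂ ∧ ν₃`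
on the total space (with `σᵢ` pulled back to `P`). -/
def checkForm (π : P → M) (σ : Fin 3 → DForm E M 2 ℝ) (ν : Fin 4 → DForm E' P 1 ℝ) :
    Fin 3 → DForm E' P 2 ℝ :=
  ![(σ 0).pullback π + (ν 0).wedge (ν 1) + (ν 2).wedge (ν 3),
    (σ 1).pullback π + (ν 0).wedge (ν 2) + (ν 3).wedge (ν 1),
    (σ 2).pullback π + (ν 0).wedge (ν 3) + (ν 1).wedge (ν 2)]

/-- `G` is the metric `ǧ = π^* g + ν₁² + ν₂² + ν₃² + ν₄²`. -/
def IsCheckMetric [IsManifold 𝓘(ℝ, E) ∞ M] [IsManifold 𝓘(ℝ, E') ∞ P]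
    (π : P → M) (g : Metric E M) (ν : Fin 4 → DForm E' P 1 ℝ) (G : Metric E' P) : Prop :=
  ∀ (p : P) (v w : TangentSpace 𝓘(ℝ, E') p),
    G.inner p v w =
      g.inner (π p) (mfderiv 𝓘(ℝ, E') 𝓘(ℝ, E) π p v) (mfderiv 𝓘(ℝ, E') 𝓘(ℝ, E) π p w)
        + ∑ i, ν i p ![v] * ν i p ![w]

end Bundle

end BalancedTorusBundle

end

/-! The differential of π and the connection forms identify each tangent space of P with T M × ℝ⁴
(`IsPrincipalT4Bundle.splitting_isInvertible`). Under this identification Ǐ_i is I_i on the first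
factor and left multiplication by a quaternion unit on the second, ǧ is an orthogonal sum and ω̌_i
is a sum of a form on each factor. The quaternion relations, the compatibility with ǧ and the
formula ω̌_i = ǧ(Ǐ_i ·, ·) therefore hold because they hold on both factors. Write u = (a, b, c),
and J_u, σ_u for the corresponding combinations.

Integrability. Choose a unit vector u' orthogonal to u. On M the form σ_{u'} + i σ_{u × u'} is
closed and of type (2,0) for J_u, and both properties survive the pullback to P. The ℝ⁴-valued form
ν intertwines the structure on P with the constant one on ℝ⁴, and dν = π^*γ is invariant because γ
is of type (1,1). Differentiating these relations shows that the Nijenhuis tensor is annihilated by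
π^*σ_{u'}, whose kernel is vertical, and by ν, hence is zero (`nijenhuis_eq_zero`). Differentiating
α ∘ J = iα then shows that dα has no (0,2)-part (`extDeriv_noZeroTwoPart`).

Balanced condition. Since σ_u is closed, dω̌ is a sum of terms λ ∧ γ_i with λ a vertical covector,
so one needs λ ∧ γ_i ∧ (σ_u + κ)^{2n} = 0, where κ is the vertical part of ω̌. Expand by the number
of factors κ. With two or more, the vertical degree is at least 5 > 4. With none, the horizontal
degree is 4n + 2 > 4n. With exactly one, the horizontal part is γ_i ∧ σ_u^{2n-1}, of top degree 4n.
The complex structure J_{u'} has determinant 1, preserves γ_i and reverses the sign of σ_u; as 2n -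
1 is odd, this top form equals its own negative and vanishes (`altSum_covector_primitive_eq_zero`).

Wedge powers are handled as alternating sums over all permutations (`altSum`, `wedgePow_apply`),
where degree counting and expansion become statements about blocks of slots. All derivatives are
computed at the base point of a preferred chart. -/

noncomputable section

namespace BalancedTorusBundle

/-! ### Tensor fields in the preferred charts -/

section ChartExpressions

variable {E : Type*} [NormedAddCommGroup E] [NormedSpace ℝ E]
  {M : Type*} [TopologicalSpace M] [ChartedSpace E M]

/-- The derivative of the preferred chart at `x₀`. -/
def toChart (x₀ x : M) : TangentSpace 𝓘(ℝ, E) x →L[ℝ] E :=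
  mfderiv 𝓘(ℝ, E) 𝓘(ℝ, E) (chartAt E x₀) x

/-- The derivative of the inverse of the preferred chart at `x₀`. -/
def fromChart (x₀ : M) (q : E) : E →L[ℝ] TangentSpace 𝓘(ℝ, E) ((chartAt E x₀).symm q) :=
  mfderiv 𝓘(ℝ, E) 𝓘(ℝ, E) (chartAt E x₀).symm q

/-- The expression of a field of endomorphisms in the preferred chart at `x₀`. -/
def EndField.inChart (J : EndField E M) (x₀ : M) (q : E) : E →L[ℝ] E :=
  toChart x₀ ((chartAt E x₀).symm q) ∘L J ((chartAt E x₀).symm q) ∘L fromChart x₀ q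

/-- The expression of a field of bilinear forms in the preferred chart at `x₀`. -/
def bilinInChart (b : (x : M) → TangentSpace 𝓘(ℝ, E) x →L[ℝ] TangentSpace 𝓘(ℝ, E) x →L[ℝ] ℝ)
    (x₀ : M) (q : E) : E →L[ℝ] E →L[ℝ] ℝ :=
  (fromChart x₀ q).precomp ℝ ∘L b ((chartAt E x₀).symm q) ∘L fromChart x₀ q

variable [IsManifold 𝓘(ℝ, E) ∞ M]

theorem fromChart_toChart {x₀ : M} {q : E} (hq : q ∈ (chartAt E x₀).target)
    (v : TangentSpace 𝓘(ℝ, E) ((chartAt E x₀).symm q)) :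
    fromChart x₀ q (toChart x₀ ((chartAt E x₀).symm q) v) = v := by
  have h := (mdifferentiable_chart (I := 𝓘(ℝ, E)) x₀).symm_comp_deriv
    ((chartAt E x₀).map_target hq)
  rw [(chartAt E x₀).right_inv hq] at h
  exact congrArg (fun L => L v) h

theorem toChart_fromChart {x₀ : M} {q : E} (hq : q ∈ (chartAt E x₀).target) (v : E) :
    toChart x₀ ((chartAt E x₀).symm q) (fromChart x₀ q v) = v :=
  congrArg (fun L => L v) ((mdifferentiable_chart (I := 𝓘(ℝ, E)) x₀).comp_symm_deriv hq)

omit [IsManifold 𝓘(ℝ, E) ∞ M] in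
theorem DForm.inChart_apply {F : Type*} [NormedAddCommGroup F] [NormedSpace ℝ F] {k : ℕ}
    (θ : DForm E M k F) (x₀ : M) (q : E) (v : Fin k → E) :
    θ.inChart x₀ q v = θ ((chartAt E x₀).symm q) (fun i => fromChart x₀ q (v i)) := rfl

/-- Smoothness in the bundles is tested in these trivializations, whereas forms are pulled back by
charts; this and `symmL_eq_fromChart` show that the two kinds of coordinates agree. -/
theorem continuousLinearMapAt_eq_toChart {x₀ x : M} (hx : x ∈ (chartAt E x₀).source) :
    (trivializationAt E (TangentSpace 𝓘(ℝ, E)) x₀).continuousLinearMapAt ℝ x =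
      toChart x₀ x := by
  rw [TangentBundle.continuousLinearMapAt_trivializationAt hx]
  rfl

theorem symmL_eq_fromChart {x₀ : M} {q : E} (hq : q ∈ (chartAt E x₀).target) :
    (trivializationAt E (TangentSpace 𝓘(ℝ, E)) x₀).symmL ℝ ((chartAt E x₀).symm q) =
      fromChart x₀ q := by
  rw [TangentBundle.symmL_trivializationAt ((chartAt E x₀).map_target hq)]
  have h : extChartAt 𝓘(ℝ, E) x₀ ((chartAt E x₀).symm q) = q := by simp [hq]
  rw [h]
  simp only [mfld_simps, mfderivWithin_univ]
  rfl

/-- A map is smooth if its composition with a chart is. -/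
theorem contMDiffAt_iff_contDiffAt_of_eventuallyEq {F : Type*} [NormedAddCommGroup F]
    [NormedSpace ℝ F] {x₀ : M} {u : M → F} {w : E → F}
    (h : ∀ q ∈ (chartAt E x₀).target, u ((chartAt E x₀).symm q) = w q) :
    ContMDiffAt 𝓘(ℝ, E) 𝓘(ℝ, F) ∞ u x₀ ↔ ContDiffAt ℝ ∞ w (chartAt E x₀ x₀) := by
  have ht : (chartAt E x₀).target ∈ 𝓝 (chartAt E x₀ x₀) :=
    (chartAt E x₀).open_target.mem_nhds (mem_chart_target E x₀)
  rw [← contMDiffAt_iff_contDiffAt]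
  constructor
  · intro hu
    have hs : ContMDiffAt 𝓘(ℝ, E) 𝓘(ℝ, E) ∞ (chartAt E x₀).symm (chartAt E x₀ x₀) :=
      (contMDiffOn_chart_symm (I := 𝓘(ℝ, E))).contMDiffAt ht
    have := ContMDiffAt.comp (chartAt E x₀ x₀) (g := u)
      (by rwa [(chartAt E x₀).left_inv (mem_chart_source E x₀)]) hs
    refine this.congr_of_eventuallyEq ?_
    filter_upwards [ht] with q hq using (h q hq).symm
  · intro hw
    have hc : ContMDiffAt 𝓘(ℝ, E) 𝓘(ℝ, E) ∞ (chartAt E x₀) x₀ :=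
      (contMDiffOn_chart (I := 𝓘(ℝ, E))).contMDiffAt
        ((chartAt E x₀).open_source.mem_nhds (mem_chart_source E x₀))
    refine (ContMDiffAt.comp x₀ hw hc).congr_of_eventuallyEq ?_
    filter_upwards [(chartAt E x₀).open_source.mem_nhds (mem_chart_source E x₀)] with y hy
    have := h _ ((chartAt E x₀).map_source hy)
    rw [(chartAt E x₀).left_inv hy] at this
    exact this

/-- The chart at x₀ is tested only at x₀ itself, which is also where `DForm.d` reads a form. -/
theorem contMDiffAt_endField_iff (J : EndField E M) (x₀ : M) :
    ContMDiffAt 𝓘(ℝ, E) (𝓘(ℝ, E).prod 𝓘(ℝ, E →L[ℝ] E)) ∞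
      (fun x : M => Bundle.TotalSpace.mk' (E →L[ℝ] E)
        (E := fun x : M => TangentSpace 𝓘(ℝ, E) x →L[ℝ] TangentSpace 𝓘(ℝ, E) x) x (J x)) x₀ ↔
    ContDiffAt ℝ ∞ (J.inChart x₀) (chartAt E x₀ x₀) := by
  rw [contMDiffAt_hom_bundle]
  refine (and_iff_right contMDiffAt_id).trans ?_
  refine contMDiffAt_iff_contDiffAt_of_eventuallyEq fun q hq => ?_
  simp only [ContinuousLinearMap.inCoordinates, EndField.inChart]
  rw [continuousLinearMapAt_eq_toChart ((chartAt E x₀).map_target hq), symmL_eq_fromChart hq]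

theorem contMDiffAt_bilin_iff
    (b : (x : M) → TangentSpace 𝓘(ℝ, E) x →L[ℝ] TangentSpace 𝓘(ℝ, E) x →L[ℝ] ℝ) (x₀ : M) :
    ContMDiffAt 𝓘(ℝ, E) (𝓘(ℝ, E).prod 𝓘(ℝ, E →L[ℝ] E →L[ℝ] ℝ)) ∞
      (fun x : M => Bundle.TotalSpace.mk' (E →L[ℝ] E →L[ℝ] ℝ)
        (E := fun x : M => TangentSpace 𝓘(ℝ, E) x →L[ℝ] TangentSpace 𝓘(ℝ, E) x →L[ℝ] ℝ)
          x (b x)) x₀ ↔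
    ContDiffAt ℝ ∞ (bilinInChart b x₀) (chartAt E x₀ x₀) := by
  rw [contMDiffAt_hom_bundle]
  refine (and_iff_right contMDiffAt_id).trans ?_
  refine contMDiffAt_iff_contDiffAt_of_eventuallyEq fun q hq => ?_
  have hs := (chartAt E x₀).map_target hq
  ext v w
  rw [inCoordinates_apply_eq₂ (by simpa using hs) (by simpa using hs) (by simp)]
  simp only [bilinInChart]
  rw [← symmL_eq_fromChart hq]
  have hb : (chartAt E x₀).symm q ∈
      (trivializationAt E (TangentSpace 𝓘(ℝ, E)) x₀).baseSet := by simpa using hs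
  simp [Bundle.Trivialization.symmL_apply _ hb]

end ChartExpressions

/-! ### The Nijenhuis tensor on a vector space -/

section Nijenhuis

variable {V : Type*} [NormedAddCommGroup V] [NormedSpace ℝ V]
  {F : Type*} [NormedAddCommGroup F] [NormedSpace ℝ F] {q : V}

theorem fderiv_oneForm_apply {α : V → V [⋀^Fin 1]→L[ℝ] F} {a : V → V}
    (hα : DifferentiableAt ℝ α q) (ha : DifferentiableAt ℝ a q) (u : V) :
    fderiv ℝ (fun q => α q ![a q]) q u = fderiv ℝ α q u ![a q] + α q ![fderiv ℝ a q u] := by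
  have h := fderiv_continuousAlternatingMap_apply_apply (g := fun _ : Fin 1 => a) hα
    (fun _ => ha) u
  have e : ∀ q, (fun _ : Fin 1 => a q) = ![a q] := fun q => by ext i; fin_cases i; rfl
  simp only [e] at h
  rw [h]
  congr 1
  simp only [Fin.sum_univ_one]
  congr 1
  ext i; fin_cases i; simp

theorem fderiv_twoForm_apply {s : V → V [⋀^Fin 2]→L[ℝ] F} {a b : V → V}
    (hs : DifferentiableAt ℝ s q) (ha : DifferentiableAt ℝ a q) (hb : DifferentiableAt ℝ b q)
    (u : V) :
    fderiv ℝ (fun q => s q ![a q, b q]) q u = fderiv ℝ s q u ![a q, b q]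
      + s q ![fderiv ℝ a q u, b q] + s q ![a q, fderiv ℝ b q u] := by
  have h := fderiv_continuousAlternatingMap_apply_apply (g := ![a, b]) hs
    (fun i => by fin_cases i <;> simpa) u
  have e : ∀ q, (fun i : Fin 2 => (![a, b] : Fin 2 → V → V) i q) = ![a q, b q] :=
    fun q => by ext i; fin_cases i <;> rfl
  simp only [e] at h
  rw [h, Fin.sum_univ_two, add_assoc]
  congr 2
  · congr 1
    ext i; fin_cases i <;> simp
  · congr 1
    ext i; fin_cases i <;> simp

theorem extDeriv_oneForm_apply (α : V → V [⋀^Fin 1]→L[ℝ] F) (v w : V) :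
    extDeriv α q ![v, w] = fderiv ℝ α q v ![w] - fderiv ℝ α q w ![v] := by
  rw [extDeriv, ContinuousAlternatingMap.alternatizeUncurryFin_apply, Fin.sum_univ_two]
  have h0 : (0 : Fin 2).removeNth ![v, w] = ![w] := by ext i; fin_cases i; rfl
  have h1 : (1 : Fin 2).removeNth ![v, w] = ![v] := by ext i; fin_cases i; rfl
  rw [h0, h1]
  simp [sub_eq_add_neg]

theorem extDeriv_twoForm_apply (s : V → V [⋀^Fin 2]→L[ℝ] F) (u v w : V) :
    extDeriv s q ![u, v, w] =
      fderiv ℝ s q u ![v, w] - fderiv ℝ s q v ![u, w] + fderiv ℝ s q w ![u, v] := by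
  rw [extDeriv, ContinuousAlternatingMap.alternatizeUncurryFin_apply, Fin.sum_univ_three]
  have h0 : (0 : Fin 3).removeNth ![u, v, w] = ![v, w] := by ext i; fin_cases i <;> rfl
  have h1 : (1 : Fin 3).removeNth ![u, v, w] = ![u, w] := by ext i; fin_cases i <;> rfl
  have h2 : (2 : Fin 3).removeNth ![u, v, w] = ![u, v] := by ext i; fin_cases i <;> rfl
  rw [h0, h1, h2]
  simp [sub_eq_add_neg]

/-- The Nijenhuis tensor of a field of endomorphisms of a vector space (up to sign and an
application of the endomorphism). -/
def nijenhuis (J : V → V →L[ℝ] V) (q v w : V) : V :=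
  fderiv ℝ J q v w - fderiv ℝ J q w v
    - J q (fderiv ℝ J q (J q w) v - fderiv ℝ J q (J q v) w)

theorem fderiv_clm_apply_const {J : V → V →L[ℝ] F} (hJ : DifferentiableAt ℝ J q) (v u : V) :
    fderiv ℝ (fun q => J q v) q u = fderiv ℝ J q u v := by
  simp [fderiv_clm_apply hJ (differentiableAt_const v)]

theorem form_smul_two (β : V [⋀^Fin 2]→L[ℝ] F) (v w : V) : β ![w, v] = - β ![v, w] := by
  have h := β.toAlternatingMap.map_swap ![v, w] (i := 0) (j := 1) (by decide)
  have e : (![v, w] ∘ Equiv.swap (0 : Fin 2) 1) = ![w, v] := by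
    ext i; fin_cases i <;> rfl
  rw [e] at h
  exact h

theorem form_add_left (β : V [⋀^Fin 2]→L[ℝ] F) (v v' w : V) :
    β ![v + v', w] = β ![v, w] + β ![v', w] := β.toAlternatingMap.map_vecCons_add ![w] v v'

theorem form_smul_left (β : V [⋀^Fin 2]→L[ℝ] F) (c : ℝ) (v w : V) :
    β ![c • v, w] = c • β ![v, w] := β.toAlternatingMap.map_vecCons_smul ![w] c v

theorem form_neg_left (β : V [⋀^Fin 2]→L[ℝ] F) (v w : V) :
    β ![-v, w] = - β ![v, w] := by simpa using form_smul_left β (-1) v w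

theorem form_sub_left (β : V [⋀^Fin 2]→L[ℝ] F) (v v' w : V) :
    β ![v - v', w] = β ![v, w] - β ![v', w] := by
  rw [sub_eq_add_neg, form_add_left, form_neg_left, sub_eq_add_neg]

theorem covector_add (β : V [⋀^Fin 1]→L[ℝ] F) (v v' : V) :
    β ![v + v'] = β ![v] + β ![v'] := β.toAlternatingMap.map_vecCons_add ![] v v'

theorem covector_smul (β : V [⋀^Fin 1]→L[ℝ] F) (c : ℝ) (v : V) :
    β ![c • v] = c • β ![v] := β.toAlternatingMap.map_vecCons_smul ![] c v

theorem covector_neg (β : V [⋀^Fin 1]→L[ℝ] F) (v : V) :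
    β ![-v] = - β ![v] := by simpa using covector_smul β (-1) v

theorem covector_sub (β : V [⋀^Fin 1]→L[ℝ] F) (v v' : V) :
    β ![v - v'] = β ![v] - β ![v'] := by
  rw [sub_eq_add_neg, covector_add, covector_neg, sub_eq_add_neg]

/-- If the Nijenhuis tensor vanishes, then the exterior derivative of a `(1,0)`-form has no
`(0,2)`-part. -/
theorem extDeriv_noZeroTwoPart {J : V → V →L[ℝ] V} {α : V → V [⋀^Fin 1]→L[ℝ] ℂ}
    (hJ : DifferentiableAt ℝ J q) (hα : DifferentiableAt ℝ α q)
    (hJJ : ∀ v, J q (J q v) = -v)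
    (hαJ : ∀ᶠ q' in 𝓝 q, ∀ v, α q' ![J q' v] = Complex.I * α q' ![v])
    (hN : ∀ v w, nijenhuis J q v w = 0) (v w : V) :
    extDeriv α q ![v, w] - extDeriv α q ![J q v, J q w]
      + Complex.I * (extDeriv α q ![J q v, w] + extDeriv α q ![v, J q w]) = 0 := by
  -- The derivative of α ∘ J = iα along u, for which the relation is needed near q and not only at
  -- q.
  have hD : ∀ u w, fderiv ℝ α q u ![J q w] + α q ![fderiv ℝ J q u w]
      = Complex.I * fderiv ℝ α q u ![w] := by
    intro u w
    have h1 := fderiv_oneForm_apply hα (a := fun q => J q w)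
      (hJ.clm_apply (differentiableAt_const w)) u
    rw [fderiv_clm_apply_const hJ] at h1
    have h2 := fderiv_oneForm_apply hα (differentiableAt_const w) u
    have h3 : (fun q' => α q' ![J q' w]) =ᶠ[𝓝 q] fun q' => Complex.I * α q' ![w] := by
      filter_upwards [hαJ] with q' h using h w
    have hd : DifferentiableAt ℝ (fun q => α q ![w]) q :=
      hα.continuousAlternatingMap_apply (g := fun i _ => (![w] : Fin 1 → V) i)
        (fun _ => differentiableAt_const _)
    have h0 : α q ![(0 : V)] = 0 := by simpa using covector_smul (α q) 0 (0 : V)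
    rw [h3.fderiv_eq, fderiv_const_mul hd] at h1
    simp only [fderiv_fun_const, smul_apply, Pi.zero_apply,
      zero_apply, h0, add_zero, smul_eq_mul] at h1 h2
    rw [← h1, h2]
  have hα0 := hαJ.self_of_nhds
  -- J applied to the Nijenhuis tensor, with J² = -1 removing the outer J: this is the combination
  -- of derivatives of J that α meets below.
  have hy : fderiv ℝ J q (J q v) w - fderiv ℝ J q (J q w) v
      + J q (fderiv ℝ J q w v - fderiv ℝ J q v w) = 0 := by
    have h := congrArg (J q) (hN v w)
    simp only [nijenhuis, map_sub, hJJ, map_zero] at h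
    rw [map_sub, ← neg_eq_zero, ← h]
    abel
  have hα1 := hα0 (fderiv ℝ J q w v - fderiv ℝ J q v w)
  have hy' := congrArg (fun z => α q ![z]) hy
  have h0 : α q ![(0 : V)] = 0 := by simpa using covector_smul (α q) 0 (0 : V)
  simp only [covector_add, covector_sub, h0] at hy' hα1
  simp only [extDeriv_oneForm_apply]
  have e1 := hD (J q v) w
  have e2 := hD (J q w) v
  have e3 := hD v w
  have e4 := hD w v
  -- The derivatives of J assemble into `hy'`; the remaining derivatives of α cancel by i² = -1.
  linear_combination hy' - hα1 - e1 + e2 + Complex.I * e3 - Complex.I * e4 + (fderiv ℝ α q v ![w] - fderiv ℝ α q w ![v]) * Complex.I_sq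

/-- A two-form criterion for the vanishing of the Nijenhuis tensor: closed forms `s`, `t` such
that `s + i t` is of type `(2,0)`, together with `(1,0)`-forms whose exterior derivatives are of
type `(1,1)`. -/
theorem nijenhuis_eq_zero {J : V → V →L[ℝ] V} {s t : V → V [⋀^Fin 2]→L[ℝ] ℝ}
    {N : V → V →L[ℝ] F} {K : F →L[ℝ] F}
    (hJ : DifferentiableAt ℝ J q) (hs : DifferentiableAt ℝ s q) (ht : DifferentiableAt ℝ t q)
    (hN : DifferentiableAt ℝ N q)
    (hJJ : ∀ v, J q (J q v) = -v)
    (hst : ∀ᶠ q' in 𝓝 q, ∀ v w, s q' ![J q' v, w] = - t q' ![v, w])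
    (hts : ∀ᶠ q' in 𝓝 q, ∀ v w, t q' ![J q' v, w] = s q' ![v, w])
    (hNJ : ∀ᶠ q' in 𝓝 q, ∀ v, N q' (J q' v) = K (N q' v))
    (hds : extDeriv s q = 0) (hdt : extDeriv t q = 0)
    (hdN : ∀ v w, fderiv ℝ N q (J q v) (J q w) - fderiv ℝ N q (J q w) (J q v)
      = fderiv ℝ N q v w - fderiv ℝ N q w v)
    (hK : ∀ x, K (K x) = -x)
    (hnondeg : ∀ x, (∀ u, s q ![x, u] = 0) → N q x = 0 → x = 0) (v w : V) :
    nijenhuis J q v w = 0 := by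
  have hJd : ∀ v, DifferentiableAt ℝ (fun q => J q v) q :=
    fun v => hJ.clm_apply (differentiableAt_const v)
  have h2 : ∀ (r : V → V [⋀^Fin 2]→L[ℝ] ℝ), DifferentiableAt ℝ r q → ∀ u v w,
      fderiv ℝ (fun q => r q ![v, w]) q u = fderiv ℝ r q u ![v, w] ∧
      fderiv ℝ (fun q => r q ![J q v, w]) q u
        = fderiv ℝ r q u ![J q v, w] + r q ![fderiv ℝ J q u v, w] := by
    intro r hr u v w
    have z1 : ∀ v, r q ![0, v] = 0 := fun v => by simpa using form_smul_left (r q) 0 0 v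
    have z2 : ∀ v, r q ![v, 0] = 0 := fun v => by rw [form_smul_two, z1, neg_zero]
    constructor
    · have := fderiv_twoForm_apply hr (differentiableAt_const v) (differentiableAt_const w) u
      simpa [z1, z2] using this
    · have := fderiv_twoForm_apply hr (hJd v) (differentiableAt_const w) u
      simpa [z1, z2, fderiv_clm_apply_const hJ] using this
  -- Differentiating s(J·, ·) = -t and t(J·, ·) = s trades a derivative of J inside a form for
  -- derivatives of the forms.
  have A : ∀ u v w, s q ![fderiv ℝ J q u v, w]
      = - fderiv ℝ t q u ![v, w] - fderiv ℝ s q u ![J q v, w] := by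
    intro u v w
    have e : (fun q' => s q' ![J q' v, w]) =ᶠ[𝓝 q] fun q' => - t q' ![v, w] := by
      filter_upwards [hst] with q' h using h v w
    have := (h2 s hs u v w).2
    rw [e.fderiv_eq, fderiv_fun_neg, neg_apply, (h2 t ht u v w).1] at this
    linarith
  have B : ∀ u v w, t q ![fderiv ℝ J q u v, w]
      = fderiv ℝ s q u ![v, w] - fderiv ℝ t q u ![J q v, w] := by
    intro u v w
    have e : (fun q' => t q' ![J q' v, w]) =ᶠ[𝓝 q] fun q' => s q' ![v, w] := by
      filter_upwards [hts] with q' h using h v w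
    have := (h2 t ht u v w).2
    rw [e.fderiv_eq, (h2 s hs u v w).1] at this
    linarith
  have hs0 := hst.self_of_nhds
  -- the part of type `(0,2)` of the derivatives of `s + i t` vanishes
  have hsym : ∀ u, fderiv ℝ t q u ![v, w] - fderiv ℝ t q u ![J q v, J q w]
      + fderiv ℝ s q u ![J q v, w] + fderiv ℝ s q u ![v, J q w] = 0 := by
    intro u
    have a1 := A u v w
    have a2 := A u w v
    have b1 := B u v (J q w)
    have hsw : s q ![w, fderiv ℝ J q u v] = - s q ![fderiv ℝ J q u v, w] := form_smul_two _ _ _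
    have b2 : t q ![fderiv ℝ J q u v, J q w] = s q ![fderiv ℝ J q u v, w] := by
      rw [form_smul_two, hts.self_of_nhds, hsw, neg_neg]
    linarith
  refine hnondeg _ (fun u => ?_) ?_
  -- In this combination of the four closedness relations the terms differentiated along u cancel by
  -- `hsym`; what is left is s evaluated on the Nijenhuis vector and u.
  · have d1 := extDeriv_twoForm_apply (q := q) t (J q v) (J q w) u
    have d2 := extDeriv_twoForm_apply (q := q) t v w u
    have d3 := extDeriv_twoForm_apply (q := q) s v (J q w) u
    have d4 := extDeriv_twoForm_apply (q := q) s (J q v) w u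
    rw [hdt] at d1 d2
    rw [hds] at d3 d4
    change (0 : ℝ) = _ at d1 d2 d3 d4
    simp only [nijenhuis, form_sub_left, hs0, A, B, map_sub]
    linarith [hsym u]
  · have hNd : ∀ u v, fderiv ℝ N q u (J q v) + N q (fderiv ℝ J q u v)
        = K (fderiv ℝ N q u v) := by
      intro u v
      have e : (fun q' => N q' (J q' v)) =ᶠ[𝓝 q] fun q' => K (N q' v) := by
        filter_upwards [hNJ] with q' h using h v
      have h1 := congrArg (fun L => L u) (fderiv_clm_apply hN (hJd v))
      have h3 : fderiv ℝ (fun q' => K (N q' v)) q u = K (fderiv ℝ N q u v) := by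
        rw [← fderiv_clm_apply_const hN v u]
        have := K.hasFDerivAt.comp q (hN.clm_apply (differentiableAt_const v)).hasFDerivAt
        exact congrArg (fun L => L u) this.fderiv
      simp only [e.fderiv_eq, h3, add_apply, ContinuousLinearMap.comp_apply,
        ContinuousLinearMap.flip_apply, fderiv_clm_apply_const hJ] at h1
      rw [h1, add_comm]
    have hNd' : ∀ u v, N q (fderiv ℝ J q u v)
        = K (fderiv ℝ N q u v) - fderiv ℝ N q u (J q v) := fun u v => by
      rw [← hNd u v]; abel
    have hN0 := hNJ.self_of_nhds
    simp only [nijenhuis, map_sub, hN0, hNd', hK]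
    -- J-invariance of dN at (v, w), and at (v, Jw), where J² = -1 turns it into a relation between
    -- mixed derivatives.
    have c1 := congrArg K (hdN v w)
    have c2 := hdN v (J q w)
    simp only [hJJ, map_neg, neg_apply, map_sub] at c1 c2
    have c3 : K (fderiv ℝ N q v w) = K (fderiv ℝ N q (J q v) (J q w))
        - K (fderiv ℝ N q (J q w) (J q v)) + K (fderiv ℝ N q w v) := by
      rw [c1]; abel
    have c4 : fderiv ℝ N q (J q w) v = fderiv ℝ N q (J q v) w + fderiv ℝ N q v (J q w)
        - fderiv ℝ N q w (J q v) := by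
      have : fderiv ℝ N q (J q w) v = fderiv ℝ N q v (J q w)
        - (fderiv ℝ N q v (J q w) - fderiv ℝ N q (J q w) v) := by abel
      rw [this, ← c2]; abel
    rw [c3, c4]
    abel

end Nijenhuis

/-! ### Alternating sums over permutations of slots -/

section Alternation

variable {ι κ : Type*} [Fintype ι] [DecidableEq ι] [Fintype κ] [DecidableEq κ] {V : Type*}

/-- The alternating sum of a function of an `ι`-tuple over all permutations of the tuple. -/
def altSum (F : (ι → V) → ℝ) (v : ι → V) : ℝ :=
  ∑ s : Equiv.Perm ι, ((Equiv.Perm.sign s : ℤ) : ℝ) * F (v ∘ s)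

theorem altSum_finset_sum {α : Type*} (S : Finset α) (F : α → (ι → V) → ℝ) (v : ι → V) :
    altSum (fun w => ∑ a ∈ S, F a w) v = ∑ a ∈ S, altSum (F a) v := by
  simp only [altSum, Finset.mul_sum]
  exact Finset.sum_comm

theorem altSum_sub (F G : (ι → V) → ℝ) (v : ι → V) :
    altSum (fun w => F w - G w) v = altSum F v - altSum G v := by
  simp only [altSum, mul_sub, Finset.sum_sub_distrib]

theorem altSum_mul_const (F : (ι → V) → ℝ) (c : ℝ) (v : ι → V) :
    altSum (fun w => F w * c) v = altSum F v * c := by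
  simp only [altSum, Finset.sum_mul, mul_assoc]

theorem altSum_reindex (e : ι ≃ κ) (G : (ι → V) → ℝ) (v : κ → V) :
    altSum (fun w : κ → V => G (w ∘ e)) v = altSum G (v ∘ e) := by
  refine (Fintype.sum_equiv e.permCongr _ _ fun s => ?_).symm
  rw [Equiv.Perm.sign_permCongr]
  congr 2
  ext i
  simp

/-- An alternating sum vanishes if the alternating sum over some of the slots does. -/
theorem altSum_sum_eq_zero (F : (ι ⊕ κ → V) → ℝ)
    (h : ∀ (a : ι → V) (b : κ → V), altSum (fun a => F (Sum.elim a b)) a = 0) (v : ι ⊕ κ → V) :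
    altSum F v = 0 := by
  -- A permutation t of the first block only reindexes the sum over s. Summing over all t then
  -- multiplies the alternating sum by a nonzero number and exhibits the vanishing alternation over
  -- the first block.
  have key : ∀ t : Equiv.Perm ι, altSum F v = ∑ s : Equiv.Perm (ι ⊕ κ),
      ((Equiv.Perm.sign s : ℤ) : ℝ) * (((Equiv.Perm.sign t : ℤ) : ℝ)
        * F (Sum.elim ((v ∘ s ∘ Sum.inl) ∘ t) (v ∘ s ∘ Sum.inr))) := by
    intro t
    refine (Fintype.sum_equiv (Equiv.mulRight (Equiv.sumCongr t (Equiv.refl κ))) _ _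
      fun s => ?_).symm
    have hs : Equiv.Perm.sign (Equiv.mulRight (Equiv.sumCongr t (Equiv.refl κ)) s)
        = Equiv.Perm.sign s * Equiv.Perm.sign t := by
      rw [Equiv.coe_mulRight, Equiv.Perm.sign_mul]
      congr 1
      simp
    rw [hs]
    push_cast
    rw [mul_assoc]
    congr 3
    ext i
    rcases i with i | i <;> simp
  have h1 : ∑ t : Equiv.Perm ι, altSum F v = 0 := by
    rw [Finset.sum_congr rfl fun t _ => key t, Finset.sum_comm]
    refine Finset.sum_eq_zero fun s _ => ?_
    rw [← Finset.mul_sum]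
    have := h (v ∘ s ∘ Sum.inl) (v ∘ s ∘ Sum.inr)
    rw [altSum] at this
    rw [this, mul_zero]
  rw [Finset.sum_const, nsmul_eq_mul] at h1
  refine (mul_eq_zero.1 h1).resolve_left ?_
  simp [Fintype.card_ne_zero]

variable [AddCommGroup V] [Module ℝ V]

theorem altSum_eq_alternatization (f : MultilinearMap ℝ (fun _ : ι => V) ℝ) (v : ι → V) :
    altSum f v = MultilinearMap.alternatization f v := by
  rw [MultilinearMap.alternatization_apply, altSum]
  refine Finset.sum_congr rfl fun s _ => ?_
  rcases Int.units_eq_one_or (Equiv.Perm.sign s) with hs | hs <;> simp [hs] <;> rfl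

variable [FiniteDimensional ℝ V]

/-- Alternating sums in more variables than the dimension vanish. -/
theorem altSum_eq_zero_of_finrank_lt (f : MultilinearMap ℝ (fun _ : ι => V) ℝ)
    (h : Module.finrank ℝ V < Fintype.card ι) (v : ι → V) : altSum f v = 0 := by
  rw [altSum_eq_alternatization]
  refine AlternatingMap.map_linearDependent _ v fun hv => ?_
  exact absurd hv.fintype_card_le_finrank (not_le.2 h)

/-- An alternating sum of top degree vanishes if it is anti-invariant under an automorphism of
determinant one. -/
theorem altSum_eq_zero_of_antiinvariant (f : MultilinearMap ℝ (fun _ : ι => V) ℝ)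
    (h : Module.finrank ℝ V = Fintype.card ι) (R : V →ₗ[ℝ] V) (hR : LinearMap.det R = 1)
    (hf : ∀ v, f (fun i => R (v i)) = - f v) (v : ι → V) : altSum f v = 0 := by
  rw [altSum_eq_alternatization]
  set A := MultilinearMap.alternatization f
  have hA : ∀ v, A (fun i => R (v i)) = - A v := by
    intro v
    rw [← altSum_eq_alternatization, ← altSum_eq_alternatization, altSum, altSum,
      ← Finset.sum_neg_distrib]
    refine Finset.sum_congr rfl fun s _ => ?_
    have := hf (v ∘ s)
    rw [← mul_neg, ← this]
    rfl
  -- There are as many slots as dimensions, so the slots index a basis and A is a multiple of its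
  -- determinant, which R preserves.
  let e : Module.Basis ι ℝ V := (Module.finBasis ℝ V).reindex (Fintype.equivOfCardEq (by simpa using h))
  have h1 : ∀ v, A v = A e * e.det v := fun v => by
    conv_lhs => rw [AlternatingMap.eq_smul_basis_det e A]
    simp
  have h2 : A (fun i => R (e i)) = A e := by
    rw [h1]
    have : e.det (fun i => R (e i)) = 1 := by
      have := e.det_comp R e
      rw [hR, e.det_self, mul_one] at this
      exact this
    rw [this, mul_one]
  have h3 : A e = 0 := by
    have := hA e
    rw [h2] at this
    linarith
  rw [h1, h3, zero_mul]

omit [FiniteDimensional ℝ V] in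
/-- A linear complex structure has determinant one. -/
theorem det_eq_one_of_sq_eq_neg (R : V →ₗ[ℝ] V) (hR : ∀ v, R (R v) = -v)
    (hV : Even (Module.finrank ℝ V)) : LinearMap.det R = 1 := by
  have h1 : LinearMap.det R * LinearMap.det R = 1 := by
    rw [← LinearMap.det_comp]
    have : R ∘ₗ R = (-1 : ℝ) • LinearMap.id := by ext v; simp [hR]
    rw [this, LinearMap.det_smul, LinearMap.det_id, mul_one, hV.neg_one_pow]
  -- (1 + R)² = 2R because R² = -1, so a positive multiple of det R is a square; this excludes det R
  -- = -1.
  have h2 : LinearMap.det (LinearMap.id + R) * LinearMap.det (LinearMap.id + R)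
      = 2 ^ Module.finrank ℝ V * LinearMap.det R := by
    rw [← LinearMap.det_comp, ← LinearMap.det_smul]
    congr 1
    ext v
    simp only [LinearMap.comp_apply, LinearMap.add_apply, LinearMap.id_apply, map_add, hR,
      two_smul]
    abel
  have h3 : 0 ≤ LinearMap.det R := by
    by_contra hneg
    have : 2 ^ Module.finrank ℝ V * LinearMap.det R < 0 :=
      mul_neg_of_pos_of_neg (by positivity) (not_le.1 hneg)
    nlinarith [mul_self_nonneg (LinearMap.det (LinearMap.id + R))]
  nlinarith

end Alternation

/-! ### Vanishing of λ ∧ γ ∧ (σ + κ)^{2n} -/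

section Products

variable {L : Type*} [Fintype L] [DecidableEq L] {V H U : Type*} [AddCommGroup V] [Module ℝ V]
  [AddCommGroup H] [Module ℝ H] [AddCommGroup U] [Module ℝ U]

/-- The tensor product of a family of bilinear forms. -/
def pairMul (B : L → MultilinearMap ℝ (fun _ : Fin 2 => V) ℝ) :
    MultilinearMap ℝ (fun _ : L × Fin 2 => V) ℝ :=
  ((MultilinearMap.mkPiAlgebra ℝ L ℝ).compMultilinearMap B).domDomCongr
    (Equiv.sigmaEquivProd L (Fin 2))

omit [DecidableEq L] in
theorem pairMul_apply (B : L → MultilinearMap ℝ (fun _ : Fin 2 => V) ℝ) (v : L × Fin 2 → V) :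
    pairMul B v = ∏ m, B m ![v (m, 0), v (m, 1)] := by
  simp only [pairMul, MultilinearMap.domDomCongr_apply, MultilinearMap.compMultilinearMap_apply,
    MultilinearMap.mkPiAlgebra_apply]
  refine Finset.prod_congr rfl fun m _ => ?_
  congr 1
  ext i
  fin_cases i <;> rfl

/-- The tensor product of a covector and a family of bilinear forms. -/
def covectorPairMul (l : V →ₗ[ℝ] ℝ) (B : L → MultilinearMap ℝ (fun _ : Fin 2 => V) ℝ) :
    MultilinearMap ℝ (fun _ : Unit ⊕ (L × Fin 2) => V) ℝ :=
  (LinearMap.mul' ℝ ℝ).compMultilinearMap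
    ((MultilinearMap.ofSubsingleton ℝ V ℝ () l).domCoprod (pairMul B))

omit [DecidableEq L] in
theorem covectorPairMul_apply (l : V →ₗ[ℝ] ℝ)
    (B : L → MultilinearMap ℝ (fun _ : Fin 2 => V) ℝ) (v : Unit ⊕ (L × Fin 2) → V) :
    covectorPairMul l B v
      = l (v (Sum.inl ())) * ∏ m, B m ![v (Sum.inr (m, 0)), v (Sum.inr (m, 1))] := by
  simp [covectorPairMul, pairMul_apply]

/-- The pairs of slots in `S` and those not in `S`. -/
def splitPairs (S : Finset L) :
    ({m // m ∈ S} × Fin 2) ⊕ ({m // m ∉ S} × Fin 2) ≃ L × Fin 2 :=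
  (Equiv.sumProdDistrib _ _ _).symm.trans
    ((Equiv.sumCompl (· ∈ S)).prodCongr (Equiv.refl _))

variable [FiniteDimensional ℝ H] [FiniteDimensional ℝ U]

/-- The covector and the factors in S occupy 1 + 2|S| ≥ 5 slots, all read through a space of
dimension 4. The other factors are frozen while these slots are alternated, so f is arbitrary. -/
theorem altSum_eq_zero_of_many_vertical (T : V →ₗ[ℝ] U) (hU : Module.finrank ℝ U = 4)
    (l : U →ₗ[ℝ] ℝ) (k : MultilinearMap ℝ (fun _ : Fin 2 => U) ℝ)
    (S : Finset L) (hS : 2 ≤ S.card) (f : L → V → V → ℝ)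
    (v : Unit ⊕ (L × Fin 2) → V) :
    altSum (fun w : Unit ⊕ (L × Fin 2) → V => l (T (w (Sum.inl ())))
      * ((∏ m : {m // m ∈ S}, k ![T (w (Sum.inr (m, 0))), T (w (Sum.inr (m, 1)))])
      * ∏ m : {m // m ∉ S}, f m (w (Sum.inr (m, 0))) (w (Sum.inr (m, 1))))) v = 0 := by
  -- The slots read through U form the first block, as `altSum_sum_eq_zero` requires.
  let e : (Unit ⊕ ({m // m ∈ S} × Fin 2)) ⊕ ({m // m ∉ S} × Fin 2) ≃ Unit ⊕ (L × Fin 2) :=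
    (Equiv.sumAssoc _ _ _).trans (Equiv.sumCongr (Equiv.refl _) (splitPairs S))
  let G : ((Unit ⊕ ({m // m ∈ S} × Fin 2)) ⊕ ({m // m ∉ S} × Fin 2) → V) → ℝ := fun u =>
    covectorPairMul l (fun _ => k) (fun i => T (u (Sum.inl i)))
      * ∏ m : {m // m ∉ S}, f m (u (Sum.inr (m, 0))) (u (Sum.inr (m, 1)))
  have hG := altSum_reindex e G v
  have hF : (fun w : Unit ⊕ (L × Fin 2) → V => G (w ∘ e)) = fun w => l (T (w (Sum.inl ())))
      * ((∏ m : {m // m ∈ S}, k ![T (w (Sum.inr (m, 0))), T (w (Sum.inr (m, 1)))])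
      * ∏ m : {m // m ∉ S}, f m (w (Sum.inr (m, 0))) (w (Sum.inr (m, 1)))) := by
    ext w
    simp only [G, covectorPairMul_apply, mul_assoc]
    rfl
  rw [← hF, hG]
  refine altSum_sum_eq_zero G (fun a b => ?_) _
  simp only [G, Sum.elim_inl, Sum.elim_inr, altSum_mul_const]
  have := altSum_eq_zero_of_finrank_lt (covectorPairMul l (fun _ : {m // m ∈ S} => k))
    (by simp [hU]; omega) (fun i => T (a i))
  rw [altSum] at this ⊢
  exact mul_eq_zero_of_left this _

-- Mirror image of the previous lemma: the slots outside S are alternated while the covector and the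
-- factors in S stay frozen.
omit [FiniteDimensional ℝ H] in
theorem altSum_eq_zero_of_horizontal (T : V →ₗ[ℝ] H)
    (B : L → MultilinearMap ℝ (fun _ : Fin 2 => H) ℝ) (S : Finset L)
    (hB : ∀ a : {m // m ∉ S} × Fin 2 → H,
      altSum (pairMul fun m : {m // m ∉ S} => B m) a = 0)
    (l : V → ℝ) (f : V → V → ℝ)
    (v : Unit ⊕ (L × Fin 2) → V) :
    altSum (fun w : Unit ⊕ (L × Fin 2) → V => l (w (Sum.inl ()))
      * ((∏ m : {m // m ∈ S}, f (w (Sum.inr (m, 0))) (w (Sum.inr (m, 1))))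
      * ∏ m : {m // m ∉ S}, B m ![T (w (Sum.inr (m, 0))), T (w (Sum.inr (m, 1)))])) v = 0 := by
  let e : ({m // m ∉ S} × Fin 2) ⊕ (Unit ⊕ ({m // m ∈ S} × Fin 2)) ≃ Unit ⊕ (L × Fin 2) :=
    (Equiv.sumComm _ _).trans
      ((Equiv.sumAssoc _ _ _).trans (Equiv.sumCongr (Equiv.refl _) (splitPairs S)))
  let G : (({m // m ∉ S} × Fin 2) ⊕ (Unit ⊕ ({m // m ∈ S} × Fin 2)) → V) → ℝ := fun u =>
    pairMul (fun m : {m // m ∉ S} => B m) (fun i => T (u (Sum.inl i)))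
      * (l (u (Sum.inr (Sum.inl ()))) * ∏ m : {m // m ∈ S},
        f (u (Sum.inr (Sum.inr (m, 0)))) (u (Sum.inr (Sum.inr (m, 1)))))
  have hG := altSum_reindex e G v
  have hF : (fun w : Unit ⊕ (L × Fin 2) → V => G (w ∘ e)) = fun w => l (w (Sum.inl ()))
      * ((∏ m : {m // m ∈ S}, f (w (Sum.inr (m, 0))) (w (Sum.inr (m, 1))))
      * ∏ m : {m // m ∉ S}, B m ![T (w (Sum.inr (m, 0))), T (w (Sum.inr (m, 1)))]) := by
    ext w
    simp only [G, pairMul_apply]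
    rw [mul_comm, mul_assoc]
    rfl
  rw [← hF, hG]
  refine altSum_sum_eq_zero G (fun a b => ?_) _
  simp only [G, Sum.elim_inl, Sum.elim_inr, altSum_mul_const]
  have := hB (fun i => T (a i))
  rw [altSum] at this ⊢
  exact mul_eq_zero_of_left this _

/-- The algebraic identity behind the balanced condition:
`λ ∧ γ ∧ (σ + κ)^{2n} = 0` for `λ`, `κ` pulled back from a space of dimension `4` and `γ`, `σ`
pulled back from a space of dimension `4n` on which `γ` is invariant and `σ` anti-invariant under
a complex structure. -/
theorem altSum_covector_primitive_eq_zero {n : ℕ} (hL : Fintype.card L = 2 * n + 1)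
    (TH : V →ₗ[ℝ] H) (TU : V →ₗ[ℝ] U)
    (hH : Module.finrank ℝ H = 4 * n) (hU : Module.finrank ℝ U = 4)
    (R : H →ₗ[ℝ] H) (hR : ∀ v, R (R v) = -v)
    (c s : MultilinearMap ℝ (fun _ : Fin 2 => H) ℝ)
    (hc : ∀ v w, c ![R v, R w] = c ![v, w]) (hs : ∀ v w, s ![R v, R w] = - s ![v, w])
    (l : U →ₗ[ℝ] ℝ) (k : MultilinearMap ℝ (fun _ : Fin 2 => U) ℝ) (j : L)
    (v : Unit ⊕ (L × Fin 2) → V) :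
    altSum (fun w => l (TU (w (Sum.inl ())))
      * c ![TH (w (Sum.inr (j, 0))), TH (w (Sum.inr (j, 1)))]
      * ∏ m ∈ Finset.univ.erase j, (k ![TU (w (Sum.inr (m, 0))), TU (w (Sum.inr (m, 1)))]
        + s ![TH (w (Sum.inr (m, 0))), TH (w (Sum.inr (m, 1)))])) v = 0 := by
  -- The factor c at position j is also horizontal; with B it joins the factors s in one product
  -- over the complement of S.
  let B : L → MultilinearMap ℝ (fun _ : Fin 2 => H) ℝ := fun m => if m = j then c else s
  have hexp : (fun w : Unit ⊕ (L × Fin 2) → V => l (TU (w (Sum.inl ())))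
      * c ![TH (w (Sum.inr (j, 0))), TH (w (Sum.inr (j, 1)))]
      * ∏ m ∈ Finset.univ.erase j, (k ![TU (w (Sum.inr (m, 0))), TU (w (Sum.inr (m, 1)))]
        + s ![TH (w (Sum.inr (m, 0))), TH (w (Sum.inr (m, 1)))])) =
      fun w => ∑ S ∈ (Finset.univ.erase j).powerset, l (TU (w (Sum.inl ())))
      * ((∏ m : {m // m ∈ S}, k ![TU (w (Sum.inr (m, 0))), TU (w (Sum.inr (m, 1)))])
      * ∏ m : {m // m ∉ S}, B m ![TH (w (Sum.inr (m, 0))), TH (w (Sum.inr (m, 1)))]) := by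
    ext w
    -- S is the set of positions at which the factor k is chosen; it never contains j.
    rw [Finset.prod_add, Finset.mul_sum]
    refine Finset.sum_congr rfl fun S hS => ?_
    have hjS : j ∉ S := fun h => Finset.notMem_erase j _ (Finset.mem_powerset.1 hS h)
    rw [mul_assoc]
    congr 1
    rw [mul_left_comm]
    congr 1
    · exact (Finset.prod_coe_sort S
        (fun m => k ![TU (w (Sum.inr (m, 0))), TU (w (Sum.inr (m, 1)))])).symm
    · rw [← Finset.prod_subtype (Sᶜ) (fun m => by simp)
        (fun m => B m ![TH (w (Sum.inr (m, 0))), TH (w (Sum.inr (m, 1)))]),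
        ← Finset.mul_prod_erase _ _ (Finset.mem_compl.2 hjS)]
      congr 1
      · simp [B]
      · refine Finset.prod_congr ?_ fun m hm => ?_
        · ext m
          simp [and_comm]
        · simp [B, Finset.ne_of_mem_erase hm]
  rw [hexp, altSum_finset_sum]
  refine Finset.sum_eq_zero fun S hS => ?_
  have hjS : j ∉ S := fun h => Finset.notMem_erase j _ (Finset.mem_powerset.1 hS h)
  rcases le_or_gt 2 S.card with h2 | h2
  · exact altSum_eq_zero_of_many_vertical TU hU l k S h2
      (fun m v w => B m ![TH v, TH w]) v
  · refine altSum_eq_zero_of_horizontal TH B S (fun a => ?_) (fun x => l (TU x))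
      (fun x y => k ![TU x, TU y]) v
    have hcard : Fintype.card {m // m ∉ S} = 2 * n + 1 - S.card := by
      rw [Fintype.card_subtype_compl, hL, Fintype.card_coe]
    rcases Nat.lt_or_ge S.card 1 with h1 | h1
    · exact altSum_eq_zero_of_finrank_lt _ (by simp [hH]; omega) a
    -- Here |S| = 1 and j ∉ S, so there are at least two positions. With n ≥ 1 the truncated
    -- exponent of -1 below is really 2n - 1, hence odd.
    · have hn : 1 ≤ n := by
        have : S.card < Fintype.card L := by
          rw [← Finset.card_univ]
          exact Finset.card_lt_card (Finset.ssubset_univ_iff.2 fun h => hjS (h ▸ Finset.mem_univ j))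
        omega
      -- Top horizontal degree: R fixes the one factor c and changes the sign of each of the 2n - 1
      -- factors s.
      refine altSum_eq_zero_of_antiinvariant _ (by simp [hH]; omega) R
        (det_eq_one_of_sq_eq_neg R hR (by rw [hH]; exact ⟨2 * n, by ring⟩)) (fun u => ?_) a
      rw [pairMul_apply, pairMul_apply,
        ← Finset.mul_prod_erase _ _ (Finset.mem_univ (⟨j, hjS⟩ : {m // m ∉ S})),
        ← Finset.mul_prod_erase _ _ (Finset.mem_univ (⟨j, hjS⟩ : {m // m ∉ S}))]
      have hB : ∀ m ∈ Finset.univ.erase (⟨j, hjS⟩ : {m // m ∉ S}),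
          B m ![R (u (m, 0)), R (u (m, 1))] = -1 * B m ![u (m, 0), u (m, 1)] := by
        intro m hm
        have : (m : L) ≠ j := fun h => Finset.ne_of_mem_erase hm (Subtype.ext h)
        simp [B, this, hs]
      rw [Finset.prod_congr rfl hB, Finset.prod_mul_distrib, Finset.prod_const,
        Finset.card_erase_of_mem (Finset.mem_univ _), Finset.card_univ, hcard]
      have hodd : Odd (2 * n + 1 - S.card - 1) := ⟨n - 1, by omega⟩
      rw [hodd.neg_one_pow]
      simp [B, hc]

end Products

/-! ### Wedge powers as alternating sums -/

section WedgePowers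

variable {V : Type*} [AddCommGroup V] [Module ℝ V] [TopologicalSpace V]

/-- In the shuffle normalisation the alternatization of a tensor product is the wedge of the
alternatizations, without factorials, so only the constants c and d multiply. -/
theorem wedge_eq_altSum {k l : ℕ} (α : V [⋀^Fin k]→L[ℝ] ℝ) (β : V [⋀^Fin l]→L[ℝ] ℝ)
    (a : MultilinearMap ℝ (fun _ : Fin k => V) ℝ) (b : MultilinearMap ℝ (fun _ : Fin l => V) ℝ)
    (c d : ℝ) (hα : ∀ v, α v = c * altSum a v) (hβ : ∀ v, β v = d * altSum b v)
    (v : Fin (k + l) → V) :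
    wedge α β v = c * d * altSum (fun w : Fin (k + l) → V =>
      a (fun i => w (Fin.castAdd l i)) * b (fun i => w (Fin.natAdd k i))) v := by
  have h1 : α.toAlternatingMap = c • MultilinearMap.alternatization a := by
    ext v
    simpa [altSum_eq_alternatization] using hα v
  have h2 : β.toAlternatingMap = d • MultilinearMap.alternatization b := by
    ext v
    simpa [altSum_eq_alternatization] using hβ v
  have h3 : α.toAlternatingMap.domCoprod β.toAlternatingMap
      = (c * d) • MultilinearMap.alternatization (a.domCoprod b) := by
    rw [h1, h2, MultilinearMap.domCoprod_alternization, ← AlternatingMap.domCoprod'_apply,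
      ← AlternatingMap.domCoprod'_apply, ← TensorProduct.smul_tmul', TensorProduct.tmul_smul,
      map_smul, map_smul, smul_smul]
  have h4 : wedge α β v = LinearMap.mul' ℝ ℝ
      (α.toAlternatingMap.domCoprod β.toAlternatingMap (v ∘ finSumFinEquiv)) := rfl
  have h5 : LinearMap.mul' ℝ ℝ (MultilinearMap.alternatization (a.domCoprod b)
      (v ∘ finSumFinEquiv)) = altSum ((LinearMap.mul' ℝ ℝ).compMultilinearMap (a.domCoprod b))
        (v ∘ finSumFinEquiv) := by
    rw [altSum_eq_alternatization, LinearMap.compMultilinearMap_alternatization]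
    rfl
  rw [h4, h3, AlternatingMap.smul_apply, map_smul, smul_eq_mul, h5,
    ← altSum_reindex (finSumFinEquiv (m := k) (n := l))]
  congr 2

theorem twoForm_eq_altSum (θ : V [⋀^Fin 2]→L[ℝ] ℝ) (v : Fin 2 → V) :
    θ v = 1 / 2 * altSum θ.toMultilinearMap v := by
  rw [altSum_eq_alternatization]
  have := AlternatingMap.coe_alternatization θ.toAlternatingMap
  have h := congrArg (fun f => f v) this
  simp only [Fintype.card_fin, Nat.factorial] at h
  change MultilinearMap.alternatization θ.toMultilinearMap v = _ at h
  rw [h]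
  change θ v = 1 / 2 * (2 • θ v)
  simp

/-- The slots of the `i`-th factor of a wedge power. -/
def pairSlot (k : ℕ) : Fin k × Fin 2 ≃ Fin (2 * k) :=
  finProdFinEquiv.trans (finCongr (mul_comm k 2))

theorem pairSlot_castSucc (k : ℕ) (i : Fin k) (j : Fin 2) :
    pairSlot (k + 1) (i.castSucc, j) = Fin.castAdd 2 (pairSlot k (i, j)) := by
  ext
  simp [pairSlot]

theorem pairSlot_last (k : ℕ) (j : Fin 2) :
    pairSlot (k + 1) (Fin.last k, j) = Fin.natAdd (2 * k) j := by
  ext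
  simp [pairSlot, add_comm]

/-- Each factor contributes 1/2 = 1/2! by `twoForm_eq_altSum`. The closed formula replaces the
recursion over shuffles and can be differentiated factor by factor. -/
theorem wedgePow_apply (θ : V [⋀^Fin 2]→L[ℝ] ℝ) (k : ℕ) (v : Fin (2 * k) → V) :
    wedgePow θ k v = (1 / 2) ^ k * altSum (fun w : Fin (2 * k) → V =>
      ∏ i, θ ![w (pairSlot k (i, 0)), w (pairSlot k (i, 1))]) v := by
  have hf : ∀ k : ℕ, (fun w : Fin (2 * k) → V =>
      ∏ i, θ ![w (pairSlot k (i, 0)), w (pairSlot k (i, 1))])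
        = (pairMul (fun _ : Fin k => θ.toMultilinearMap)).domDomCongr (pairSlot k) := by
    intro k
    ext w
    rw [MultilinearMap.domDomCongr_apply, pairMul_apply]
    rfl
  induction k with
  | zero => simp [wedgePow, altSum]
  | succ k ih =>
    have h := wedge_eq_altSum (wedgePow θ k) θ
      ((pairMul (fun _ : Fin k => θ.toMultilinearMap)).domDomCongr (pairSlot k))
      θ.toMultilinearMap ((1 / 2) ^ k) (1 / 2) (fun v => by rw [ih, hf]) (twoForm_eq_altSum θ) v
    rw [wedgePow, pow_succ]
    refine h.trans ?_
    congr 2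
    ext w
    rw [Fin.prod_univ_castSucc, ← hf]
    simp only [pairSlot_castSucc, pairSlot_last]
    congr 1
    change θ _ = θ _
    congr 1
    ext i
    fin_cases i <;> rfl

theorem wedge_one_one_apply (α β : V [⋀^Fin 1]→L[ℝ] ℝ) (v w : V) :
    wedge α β ![v, w] = α ![v] * β ![w] - α ![w] * β ![v] := by
  have h : ∀ (θ : V [⋀^Fin 1]→L[ℝ] ℝ) v, θ v = 1 * altSum θ.toMultilinearMap v := by
    intro θ v
    simp [altSum]
  rw [wedge_eq_altSum α β _ _ 1 1 (h α) (h β), altSum]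
  change 1 * 1 * ∑ s : Equiv.Perm (Fin 2), _ = _
  have hp : (Finset.univ : Finset (Equiv.Perm (Fin 2))) = {1, Equiv.swap 0 1} := by decide
  rw [hp, Finset.sum_pair (by decide)]
  have e : ∀ x : V, (fun _ : Fin 1 => x) = ![x] := fun x => by ext i; fin_cases i; rfl
  have e1 : ∀ s : Equiv.Perm (Fin 2), (fun i => (![v, w] ∘ s) (Fin.castAdd 1 i)) =
      ![![v, w] (s 0)] := fun s => by ext i; fin_cases i; rfl
  have e2 : ∀ s : Equiv.Perm (Fin 2), (fun i => (![v, w] ∘ s) (Fin.natAdd 1 i)) =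
      ![![v, w] (s 1)] := fun s => by ext i; fin_cases i; rfl
  rw [e1, e1, e2, e2]
  simp
  ring

end WedgePowers

/-! ### The exterior derivative of a wedge power -/

section ExteriorDerivative

/-- Cofactor expansion along slot 0, in the shape of the formula for `extDeriv`. -/
theorem altSum_fin_succ {V : Type*} {n : ℕ} (G : (Fin (n + 1) → V) → ℝ) (v : Fin (n + 1) → V) :
    altSum G v = ∑ i : Fin (n + 1), (-1) ^ (i : ℕ) *
      altSum (fun w : Fin n → V => G (Fin.cons (v i) w)) (i.removeNth v) := by
  -- The pair (i, s) gives the permutation with 0 ↦ i which is s on the remaining slots; its sign is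
  -- (-1)^i sign s.
  let τ : Fin (n + 1) × Equiv.Perm (Fin n) → Equiv.Perm (Fin (n + 1)) := fun p =>
    p.1.cycleRange.symm * Equiv.Perm.decomposeFin.symm (0, p.2)
  have h0 : ∀ p, τ p 0 = p.1 := fun p => by simp [τ, Fin.cycleRange_symm_zero]
  have hs : ∀ p j, τ p (Fin.succ j) = p.1.succAbove (p.2 j) := fun p j => by
    simp [τ, Fin.cycleRange_symm_succ]
  have hτ : Function.Bijective τ := by
    rw [Fintype.bijective_iff_injective_and_card]
    refine ⟨fun p p' h => ?_, ?_⟩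
    · have h1 : p.1 = p'.1 := by rw [← h0 p, ← h0 p', h]
      refine Prod.ext h1 (Equiv.ext fun j => ?_)
      have := hs p j
      rw [h, hs p' j, h1] at this
      exact (Fin.succAbove_right_injective this).symm
    · simp [Fintype.card_perm, Nat.factorial_succ]
  rw [altSum, ← hτ.sum_comp, Fintype.sum_prod_type]
  refine Finset.sum_congr rfl fun i _ => ?_
  rw [altSum, Finset.mul_sum]
  refine Finset.sum_congr rfl fun s _ => ?_
  have hsign : ((Equiv.Perm.sign (τ (i, s)) : ℤ) : ℝ)
      = (-1) ^ (i : ℕ) * ((Equiv.Perm.sign s : ℤ) : ℝ) := by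
    simp [τ, Equiv.Perm.sign_mul, Fin.sign_cycleRange, Equiv.Perm.decomposeFin.symm_sign]
  rw [hsign, mul_assoc]
  congr 3
  ext j
  refine Fin.cases ?_ (fun j => ?_) j
  · simp [h0]
  · simp [hs, Fin.removeNth]

variable {V : Type*} [NormedAddCommGroup V] [NormedSpace ℝ V] [FiniteDimensional ℝ V]
  {W : Type*} [NormedAddCommGroup W] [NormedSpace ℝ W]

/-- In finite dimension, differentiability of alternating forms can be checked on vectors. -/
theorem differentiableAt_of_forall_apply {k : ℕ} {f : W → V [⋀^Fin k]→L[ℝ] ℝ} {q : W}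
    (h : ∀ v, DifferentiableAt ℝ (fun x => f x v) q) : DifferentiableAt ℝ f q := by
  let b := Module.finBasis ℝ V
  let ev : (V [⋀^Fin k]→L[ℝ] ℝ) →ₗ[ℝ] ((Fin k → Fin (Module.finrank ℝ V)) → ℝ) :=
    { toFun := fun φ i => φ fun j => b (i j)
      map_add' := fun _ _ => rfl
      map_smul' := fun _ _ => rfl }
  -- An alternating form is determined by its values on basis tuples; a linear left inverse of `ev`
  -- recovers f from finitely many differentiable functions.
  have hinj : LinearMap.ker ev = ⊥ := by
    rw [LinearMap.ker_eq_bot']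
    intro φ hφ
    have : φ.toAlternatingMap = 0 :=
      b.ext_alternating fun i _ => congrFun hφ i
    ext v
    exact congrArg (fun ψ => ψ v) this
  have : FiniteDimensional ℝ (V [⋀^Fin k]→L[ℝ] ℝ) :=
    FiniteDimensional.of_injective ev (LinearMap.ker_eq_bot.1 hinj)
  obtain ⟨g, hg⟩ := ev.exists_leftInverse_of_injective hinj
  have hf : f = fun x => LinearMap.toContinuousLinearMap g (ev (f x)) := by
    ext1 x
    exact (congrArg (fun L => L (f x)) hg).symm
  rw [hf]
  refine (LinearMap.toContinuousLinearMap g).differentiableAt.comp q ?_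
  exact differentiableAt_pi.2 fun i => h _

/-- Leibniz rule: j is the position of the differentiated factor. Slot 0 carries the direction of
differentiation, and by `altSum_fin_succ` its alternation merges with that of the other 2k slots. -/
theorem extDeriv_wedgePow_apply {θ : V → V [⋀^Fin 2]→L[ℝ] ℝ} {q : V}
    (hθ : DifferentiableAt ℝ θ q) (k : ℕ) (v : Fin (2 * k + 1) → V) :
    extDeriv (fun q => wedgePow (θ q) k) q v = (1 / 2) ^ k *
      ∑ j : Fin k, altSum (fun w : Fin (2 * k + 1) → V =>
        fderiv ℝ θ q (w 0) ![w (pairSlot k (j, 0)).succ, w (pairSlot k (j, 1)).succ]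
        * ∏ i ∈ Finset.univ.erase j,
          θ q ![w (pairSlot k (i, 0)).succ, w (pairSlot k (i, 1)).succ]) v := by
  have hθ2 : ∀ a b : V, HasFDerivAt (fun q => θ q ![a, b])
      ((ContinuousAlternatingMap.apply ℝ V ℝ ![a, b]) ∘L fderiv ℝ θ q) q := fun a b =>
    (ContinuousAlternatingMap.apply ℝ V ℝ ![a, b]).hasFDerivAt.comp q hθ.hasFDerivAt
  have hd : ∀ w : Fin (2 * k) → V, HasFDerivAt (fun q => wedgePow (θ q) k w)
      ((1 / 2 : ℝ) ^ k • ∑ s : Equiv.Perm (Fin (2 * k)), ((Equiv.Perm.sign s : ℤ) : ℝ) •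
        ∑ j, (∏ i ∈ Finset.univ.erase j,
          θ q ![w (s (pairSlot k (i, 0))), w (s (pairSlot k (i, 1)))]) •
        ((ContinuousAlternatingMap.apply ℝ V ℝ
          ![w (s (pairSlot k (j, 0))), w (s (pairSlot k (j, 1)))]) ∘L fderiv ℝ θ q)) q := by
    intro w
    simp only [wedgePow_apply, altSum]
    refine HasFDerivAt.const_mul (HasFDerivAt.fun_sum fun s _ => HasFDerivAt.const_mul ?_ _) _
    exact HasFDerivAt.finsetProd fun i _ => hθ2 _ _
  have hdiff : DifferentiableAt ℝ (fun q => wedgePow (θ q) k) q :=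
    differentiableAt_of_forall_apply fun w => (hd w).differentiableAt
  rw [extDeriv_apply hdiff]
  simp only [(hd _).fderiv]
  rw [← altSum_finset_sum, altSum_fin_succ, Finset.mul_sum]
  refine Finset.sum_congr rfl fun i _ => ?_
  simp only [altSum, smul_apply, sum_apply,
    ContinuousLinearMap.comp_apply, ContinuousAlternatingMap.apply_apply, smul_eq_mul,
    Fin.cons_zero, Fin.cons_succ, Function.comp_apply, zsmul_eq_mul]
  push_cast
  rw [mul_left_comm]
  congr 3
  ext s
  congr 1
  refine Finset.sum_congr rfl fun j _ => ?_
  rw [mul_comm]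

end ExteriorDerivative

/-! ### The balanced condition at a point of a chart -/

section BalancedCondition

theorem altSum_fin_two {V : Type*} (F : (Fin 2 → V) → ℝ) (v w : V) :
    altSum F ![v, w] = F ![v, w] - F ![w, v] := by
  have hp : (Finset.univ : Finset (Equiv.Perm (Fin 2))) = {1, Equiv.swap 0 1} := by decide
  have e : (![v, w] ∘ Equiv.swap (0 : Fin 2) 1) = ![w, v] := by
    ext i; fin_cases i <;> rfl
  rw [altSum, hp, Finset.sum_pair (by decide), e]
  simp [sub_eq_add_neg]

theorem altSum_fin_three {V : Type*} (D : V → V → V → ℝ) (v : Fin 3 → V)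
    (hD : ∀ u v w, D u v w - D u w v - (D v u w - D v w u) + (D w u v - D w v u) = 0) :
    altSum (fun a : Fin 3 → V => D (a 0) (a 1) (a 2)) v = 0 := by
  rw [altSum_fin_succ, Fin.sum_univ_three]
  have h0 : (0 : Fin 3).removeNth v = ![v 1, v 2] := by ext i; fin_cases i <;> rfl
  have h1 : (1 : Fin 3).removeNth v = ![v 0, v 2] := by ext i; fin_cases i <;> rfl
  have h2 : (2 : Fin 3).removeNth v = ![v 0, v 1] := by ext i; fin_cases i <;> rfl
  rw [h0, h1, h2, altSum_fin_two, altSum_fin_two, altSum_fin_two, ← hD (v 0) (v 1) (v 2)]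
  have e1 : ∀ x a b : V, (Fin.cons x ![a, b] : Fin 3 → V) 1 = a := fun _ _ _ => rfl
  have e2 : ∀ x a b : V, (Fin.cons x ![a, b] : Fin 3 → V) 2 = b := fun _ _ _ => rfl
  simp only [Fin.cons_zero, e1, e2]
  norm_num
  ring

/-- An alternating sum vanishes if the alternating sum over three particular slots does. -/
theorem altSum_eq_zero_of_triple {L : Type*} [Fintype L] [DecidableEq L] {V : Type*}
    (D : V → V → V → ℝ)
    (hD : ∀ u v w, D u v w - D u w v - (D v u w - D v w u) + (D w u v - D w v u) = 0)
    (f : V → V → ℝ) (j : L) (v : Unit ⊕ (L × Fin 2) → V) :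
    altSum (fun w : Unit ⊕ (L × Fin 2) → V =>
      D (w (Sum.inl ())) (w (Sum.inr (j, 0))) (w (Sum.inr (j, 1)))
        * ∏ m ∈ Finset.univ.erase j, f (w (Sum.inr (m, 0))) (w (Sum.inr (m, 1)))) v = 0 := by
  let x : {m // m ∈ ({j} : Finset L)} := ⟨j, by simp⟩
  let t : Fin 3 → Unit ⊕ ({m // m ∈ ({j} : Finset L)} × Fin 2) :=
    ![Sum.inl (), Sum.inr (x, 0), Sum.inr (x, 1)]
  have ht : Function.Bijective t := by
    rw [Fintype.bijective_iff_injective_and_card]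
    refine ⟨fun a b h => ?_, by simp⟩
    fin_cases a <;> fin_cases b <;> simp_all [t]
  let e : Fin 3 ⊕ ({m // m ∉ ({j} : Finset L)} × Fin 2) ≃ Unit ⊕ (L × Fin 2) :=
    (Equiv.sumCongr (Equiv.ofBijective t ht) (Equiv.refl _)).trans
    ((Equiv.sumAssoc _ _ _).trans (Equiv.sumCongr (Equiv.refl _) (splitPairs {j})))
  let G : (Fin 3 ⊕ ({m // m ∉ ({j} : Finset L)} × Fin 2) → V) → ℝ := fun u =>
    D (u (Sum.inl 0)) (u (Sum.inl 1)) (u (Sum.inl 2))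
      * ∏ m : {m // m ∉ ({j} : Finset L)}, f (u (Sum.inr (m, 0))) (u (Sum.inr (m, 1)))
  have hG := altSum_reindex e G v
  have hF : (fun w : Unit ⊕ (L × Fin 2) → V => G (w ∘ e)) = fun w =>
      D (w (Sum.inl ())) (w (Sum.inr (j, 0))) (w (Sum.inr (j, 1)))
        * ∏ m ∈ Finset.univ.erase j, f (w (Sum.inr (m, 0))) (w (Sum.inr (m, 1))) := by
    ext w
    have := Finset.prod_subtype (Finset.univ.erase j)
      (p := fun m => m ∉ ({j} : Finset L)) (F := inferInstance) (fun m => by simp)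
      (fun m => f (w (Sum.inr (m, 0))) (w (Sum.inr (m, 1))))
    rw [this]
    rfl
  rw [← hF, hG]
  refine altSum_sum_eq_zero G (fun a b => ?_) _
  simp only [G, Sum.elim_inl, Sum.elim_inr, altSum_mul_const]
  rw [altSum_fin_three D a hD, zero_mul]

/-- All slots of the exterior derivative of a wedge power. -/
def derivSlot (k : ℕ) : Unit ⊕ (Fin k × Fin 2) ≃ Fin (2 * k + 1) :=
  ((Equiv.sumComm _ _).trans (Equiv.sumCongr (pairSlot k) (Equiv.refl _))).trans
    ((Equiv.optionEquivSumPUnit _).symm.trans (finSuccEquiv _).symm)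

variable {V : Type*} [NormedAddCommGroup V] [NormedSpace ℝ V] [FiniteDimensional ℝ V]
  {H : Type*} [NormedAddCommGroup H] [NormedSpace ℝ H] [FiniteDimensional ℝ H]
  {U : Type*} [NormedAddCommGroup U] [NormedSpace ℝ U] [FiniteDimensional ℝ U]

/-- T and N q are the horizontal and vertical components, κ is the fibre form and the c i are the
curvatures. As s is closed, dθ = Σ l_i(N) ∧ c_i, and each term of dθ ∧ θ^{2n} vanishes by
`altSum_covector_primitive_eq_zero`. -/
theorem extDeriv_wedgePow_eq_zero {n : ℕ} {θ s : V → V [⋀^Fin 2]→L[ℝ] ℝ} {N : V → V →L[ℝ] U}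
    {q : V} (hH : Module.finrank ℝ H = 4 * n) (hU : Module.finrank ℝ U = 4)
    (T : V →L[ℝ] H) (κ : U [⋀^Fin 2]→L[ℝ] ℝ) (s₀ : H [⋀^Fin 2]→L[ℝ] ℝ)
    (c : Fin 4 → H [⋀^Fin 2]→L[ℝ] ℝ) (e : Fin 4 → U) (R : H →L[ℝ] H)
    (hs : DifferentiableAt ℝ s q) (hN : DifferentiableAt ℝ N q)
    (hθ : ∀ᶠ q' in 𝓝 q, ∀ v w, θ q' ![v, w] = s q' ![v, w] + κ ![N q' v, N q' w])
    (hds : extDeriv s q = 0) (hs₀ : ∀ v w, s q ![v, w] = s₀ ![T v, T w])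
    (hdN : ∀ v w, fderiv ℝ N q v w - fderiv ℝ N q w v = ∑ i, c i ![T v, T w] • e i)
    (hR : ∀ v, R (R v) = -v) (hRc : ∀ i v w, c i ![R v, R w] = c i ![v, w])
    (hRs : ∀ v w, s₀ ![R v, R w] = - s₀ ![v, w]) :
    extDeriv (fun q => wedgePow (θ q) (2 * n + 1)) q = 0 := by
  have hNd : ∀ v, DifferentiableAt ℝ (fun q => N q v) q :=
    fun v => hN.clm_apply (differentiableAt_const v)
  have hκd : ∀ v w u, DifferentiableAt ℝ (fun q => κ ![N q v, N q w]) q ∧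
      fderiv ℝ (fun q => κ ![N q v, N q w]) q u
        = κ ![fderiv ℝ N q u v, N q w] + κ ![N q v, fderiv ℝ N q u w] := by
    intro v w u
    have h := HasFDerivAt.continuousAlternatingMap_apply (f := fun _ => κ)
      (g := ![fun q => N q v, fun q => N q w])
      (g' := ![fderiv ℝ (fun q => N q v) q, fderiv ℝ (fun q => N q w) q])
      (hasFDerivAt_const κ q) (fun i => by
        fin_cases i
        · exact (hNd v).hasFDerivAt
        · exact (hNd w).hasFDerivAt)
    have e : ∀ q, (fun i : Fin 2 => (![fun q => N q v, fun q => N q w] : Fin 2 → V → U) i q)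
        = ![N q v, N q w] := fun q => by ext i; fin_cases i <;> rfl
    simp only [e] at h
    refine ⟨h.differentiableAt, ?_⟩
    rw [h.fderiv]
    simp only [Fin.sum_univ_two, ContinuousLinearMap.comp_zero, zero_add, add_apply,
      ContinuousLinearMap.comp_apply, Matrix.cons_val_zero, Matrix.cons_val_one,
      fderiv_clm_apply_const hN, ContinuousAlternatingMap.toContinuousLinearMap_apply]
    congr 2 <;> · ext i; fin_cases i <;> simp
  have hsd : ∀ v w u, DifferentiableAt ℝ (fun q => s q ![v, w]) q ∧
      fderiv ℝ (fun q => s q ![v, w]) q u = fderiv ℝ s q u ![v, w] := by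
    intro v w u
    have h := (ContinuousAlternatingMap.apply ℝ V ℝ ![v, w]).hasFDerivAt.comp q hs.hasFDerivAt
    exact ⟨h.differentiableAt, congrArg (fun L => L u) h.fderiv⟩
  have hθe : ∀ v w, (fun q' => θ q' ![v, w]) =ᶠ[𝓝 q]
      fun q' => s q' ![v, w] + κ ![N q' v, N q' w] := fun v w => by
    filter_upwards [hθ] with q' h using h v w
  have hθd : DifferentiableAt ℝ θ q := by
    refine differentiableAt_of_forall_apply fun v => ?_
    have hv : v = ![v 0, v 1] := by ext i; fin_cases i <;> rfl
    rw [hv]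
    exact (((hsd _ _ 0).1.add (hκd _ _ 0).1).congr_of_eventuallyEq (hθe _ _))
  have hDθ : ∀ u v w, fderiv ℝ θ q u ![v, w] = fderiv ℝ s q u ![v, w]
      + (κ ![fderiv ℝ N q u v, N q w] + κ ![N q v, fderiv ℝ N q u w]) := by
    intro u v w
    have h := (ContinuousAlternatingMap.apply ℝ V ℝ ![v, w]).hasFDerivAt.comp q hθd.hasFDerivAt
    have h' : fderiv ℝ (fun q => θ q ![v, w]) q u = fderiv ℝ θ q u ![v, w] :=
      congrArg (fun L => L u) h.fderiv
    rw [← h', (hθe v w).fderiv_eq, fderiv_fun_add (hsd v w u).1 (hκd v w u).1, add_apply,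
      (hsd v w u).2, (hκd v w u).2]
  -- This is the contraction κ(e_i, ·), written with its arguments exchanged: it appears when one N
  -- in κ(N, N) is replaced by dN.
  let l : Fin 4 → U →ₗ[ℝ] ℝ := fun i =>
    { toFun := fun x => - κ ![x, e i]
      map_add' := fun x y => by rw [form_add_left, neg_add]
      map_smul' := fun a x => by rw [form_smul_left]; simp }
  have hdκ : ∀ u v w, κ ![fderiv ℝ N q u v, N q w] - κ ![fderiv ℝ N q v u, N q w]
      = ∑ i, l i (N q w) * c i ![T u, T v] := by
    intro u v w
    rw [← form_sub_left, hdN, form_smul_two]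
    have hsum : ∀ f : Fin 4 → ℝ, κ ![N q w, ∑ i, f i • e i] = ∑ i, f i * κ ![N q w, e i] := by
      intro f
      have hl : ∀ x, κ ![N q w, x] = κ.curryLeft (N q w) ![x] := fun _ => rfl
      simp only [Fin.sum_univ_four, hl, covector_add, covector_smul, smul_eq_mul]
    rw [hsum, ← Finset.sum_neg_distrib]
    exact Finset.sum_congr rfl fun i _ => by simp [l, mul_comm]
  have hextθ : ∀ u v w, fderiv ℝ θ q u ![v, w] - fderiv ℝ θ q v ![u, w] + fderiv ℝ θ q w ![u, v]
      = ∑ i, (l i (N q w) * c i ![T u, T v] - l i (N q v) * c i ![T u, T w]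
        + l i (N q u) * c i ![T v, T w]) := by
    intro u v w
    have h0 := extDeriv_twoForm_apply (q := q) s u v w
    rw [hds] at h0
    change (0 : ℝ) = _ at h0
    rw [Finset.sum_add_distrib, Finset.sum_sub_distrib, ← hdκ, ← hdκ, ← hdκ, hDθ, hDθ, hDθ,
      form_smul_two κ (fderiv ℝ N q u w), form_smul_two κ (fderiv ℝ N q v w),
      form_smul_two κ (fderiv ℝ N q w v)]
    linarith
  ext v
  rw [extDeriv_wedgePow_apply hθd]
  change _ = (0 : ℝ)
  refine mul_eq_zero_of_right _ (Finset.sum_eq_zero fun j _ => ?_)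
  let f : V → V → ℝ := fun v w => κ.toMultilinearMap ![N q v, N q w]
    + s₀.toMultilinearMap ![T v, T w]
  have hf : ∀ v w, θ q ![v, w] = f v w := fun v w => by
    rw [hθ.self_of_nhds, hs₀, add_comm]
    rfl
  -- D and the derivative of θ have the same alternation over three slots, so by
  -- `altSum_eq_zero_of_triple` D may replace that derivative in the full alternating sum.
  let D : V → V → V → ℝ := fun u v w => ∑ i, l i (N q u) * (c i).toMultilinearMap ![T v, T w]
  have hre := altSum_reindex (derivSlot (2 * n + 1))
    (fun w => fderiv ℝ θ q (w (Sum.inl ())) ![w (Sum.inr (j, 0)), w (Sum.inr (j, 1))]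
      * ∏ m ∈ Finset.univ.erase j, f (w (Sum.inr (m, 0))) (w (Sum.inr (m, 1)))) v
  have htr := altSum_eq_zero_of_triple
    (fun u v w => fderiv ℝ θ q u ![v, w] - D u v w) (fun u v w => by
      have h1 := hextθ u v w
      have hc : ∀ i v w, (c i).toMultilinearMap ![T v, T w] = c i ![T v, T w] :=
        fun _ _ _ => rfl
      simp only [D, hc]
      rw [form_smul_two (fderiv ℝ θ q u) v w, form_smul_two (fderiv ℝ θ q v) u w,
        form_smul_two (fderiv ℝ θ q w) u v]
      simp only [Fin.sum_univ_four] at h1 ⊢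
      simp only [fun i => form_smul_two (c i) (T v) (T w), fun i => form_smul_two (c i) (T u) (T w),
        fun i => form_smul_two (c i) (T u) (T v)]
      linarith) f j (v ∘ derivSlot (2 * n + 1))
  simp only [sub_mul, altSum_sub] at htr
  have hD : altSum (fun w : Unit ⊕ (Fin (2 * n + 1) × Fin 2) → V =>
      D (w (Sum.inl ())) (w (Sum.inr (j, 0))) (w (Sum.inr (j, 1)))
        * ∏ m ∈ Finset.univ.erase j, f (w (Sum.inr (m, 0))) (w (Sum.inr (m, 1))))
        (v ∘ derivSlot (2 * n + 1)) = 0 := by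
    simp only [D, Finset.sum_mul, altSum_finset_sum]
    refine Finset.sum_eq_zero fun i _ => ?_
    exact altSum_covector_primitive_eq_zero (L := Fin (2 * n + 1)) (by simp) T.toLinearMap
      (N q).toLinearMap hH hU R.toLinearMap hR (c i).toMultilinearMap s₀.toMultilinearMap
      (hRc i) hRs (l i) κ.toMultilinearMap j _
  rw [hD, sub_zero, ← hre] at htr
  rw [← htr]
  congr 1
  ext w
  simp only [hf]
  rfl

end BalancedCondition

/-! ### Exterior derivative and integrability read in charts -/

section ChartCalculus

variable {E : Type*} [NormedAddCommGroup E] [NormedSpace ℝ E]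
  {M : Type*} [TopologicalSpace M] [ChartedSpace E M] [IsManifold 𝓘(ℝ, E) ∞ M]
  {F : Type*} [NormedAddCommGroup F] [NormedSpace ℝ F]

omit [NormedSpace ℝ E] [IsManifold 𝓘(ℝ, E) ∞ M] in
theorem exists_chart_symm_eq {x₀ y : M} (hy : y ∈ (chartAt E x₀).source) :
    ∃ q ∈ (chartAt E x₀).target, (chartAt E x₀).symm q = y :=
  ⟨chartAt E x₀ y, (chartAt E x₀).map_source hy, (chartAt E x₀).left_inv hy⟩

theorem DForm.inChart_toChart {k : ℕ} (θ : DForm E M k F) {x₀ y : M}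
    (hy : y ∈ (chartAt E x₀).source) (v : Fin k → TangentSpace 𝓘(ℝ, E) y) :
    θ.inChart x₀ (chartAt E x₀ y) (fun i => toChart x₀ y (v i)) = θ y v := by
  obtain ⟨q, hq, rfl⟩ := exists_chart_symm_eq hy
  rw [(chartAt E x₀).right_inv hq, DForm.inChart_apply]
  simp only [fromChart_toChart hq]

theorem EndField.inChart_toChart (J : EndField E M) {x₀ y : M}
    (hy : y ∈ (chartAt E x₀).source) (v : TangentSpace 𝓘(ℝ, E) y) :
    J.inChart x₀ (chartAt E x₀ y) (toChart x₀ y v) = toChart x₀ y (J y v) := by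
  obtain ⟨q, hq, rfl⟩ := exists_chart_symm_eq hy
  rw [(chartAt E x₀).right_inv hq, EndField.inChart]
  simp only [ContinuousLinearMap.comp_apply, fromChart_toChart hq]

theorem EndField.fromChart_inChart (J : EndField E M) {x₀ : M} {q : E}
    (hq : q ∈ (chartAt E x₀).target) (v : E) :
    fromChart x₀ q (J.inChart x₀ q v) = J ((chartAt E x₀).symm q) (fromChart x₀ q v) := by
  rw [EndField.inChart]
  simp only [ContinuousLinearMap.comp_apply, fromChart_toChart hq]

theorem bilinInChart_toChart
    (b : (x : M) → TangentSpace 𝓘(ℝ, E) x →L[ℝ] TangentSpace 𝓘(ℝ, E) x →L[ℝ] ℝ) {x₀ y : M}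
    (hy : y ∈ (chartAt E x₀).source) (v w : TangentSpace 𝓘(ℝ, E) y) :
    bilinInChart b x₀ (chartAt E x₀ y) (toChart x₀ y v) (toChart x₀ y w) = b y v w := by
  obtain ⟨q, hq, rfl⟩ := exists_chart_symm_eq hy
  rw [(chartAt E x₀).right_inv hq, bilinInChart]
  simp only [ContinuousLinearMap.comp_apply, fromChart_toChart hq,
    ContinuousLinearMap.precomp_apply]

theorem toChart_surjective {x₀ y : M} (hy : y ∈ (chartAt E x₀).source) (w : E) :
    ∃ v, toChart x₀ y v = w := by
  obtain ⟨q, hq, rfl⟩ := exists_chart_symm_eq hy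
  exact ⟨_, toChart_fromChart hq w⟩

theorem toChart_injective {x₀ y : M} (hy : y ∈ (chartAt E x₀).source) :
    Function.Injective (toChart (E := E) x₀ y) := by
  obtain ⟨q, hq, rfl⟩ := exists_chart_symm_eq hy
  exact Function.LeftInverse.injective (fromChart_toChart hq)

omit [IsManifold 𝓘(ℝ, E) ∞ M] in
theorem DForm.d_apply {k : ℕ} (θ : DForm E M k F) (x : M)
    (v : Fin (k + 1) → TangentSpace 𝓘(ℝ, E) x) :
    θ.d x v = extDeriv (θ.inChart x) (chartAt E x x) (fun i => toChart x x (v i)) := rfl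

theorem DForm.extDeriv_inChart_eq_zero {k : ℕ} {θ : DForm E M k F} {x : M} (h : θ.d x = 0) :
    extDeriv (θ.inChart x) (chartAt E x x) = 0 := by
  ext w
  choose v hv using fun i => toChart_surjective (mem_chart_source E x) (w i)
  have := θ.d_apply x v
  simp only [hv] at this
  rw [← this, h]
  rfl

omit [IsManifold 𝓘(ℝ, E) ∞ M] in
theorem DForm.d_eq_zero_of_extDeriv {k : ℕ} {θ : DForm E M k F}
    (h : ∀ x, extDeriv (θ.inChart x) (chartAt E x x) = 0) : θ.d = 0 := by
  ext x v
  rw [DForm.d_apply, h]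
  rfl

omit [IsManifold 𝓘(ℝ, E) ∞ M] in
theorem toChart_vec_two {x₀ y : M} (v w : TangentSpace 𝓘(ℝ, E) y) :
    (fun i => toChart x₀ y ((![v, w] : Fin 2 → TangentSpace 𝓘(ℝ, E) y) i))
      = ![toChart x₀ y v, toChart x₀ y w] := by
  ext i; fin_cases i <;> rfl

omit [NormedSpace ℝ E] [IsManifold 𝓘(ℝ, E) ∞ M] in
theorem chart_target_mem_nhds (x : M) : (chartAt E x).target ∈ 𝓝 (chartAt E x x) :=
  (chartAt E x).open_target.mem_nhds (mem_chart_target E x)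

/-- A smooth almost complex structure with vanishing Nijenhuis tensor is integrable. -/
theorem isIntegrable_of_nijenhuis_eq_zero {J : EndField E M}
    (hJ : ∀ x, ContDiffAt ℝ ∞ (J.inChart x) (chartAt E x x))
    (hJJ : ∀ (x : M) (v : TangentSpace 𝓘(ℝ, E) x), J x (J x v) = -v)
    (hN : ∀ (x : M) v w, nijenhuis (J.inChart x) (chartAt E x x) v w = 0) : IsIntegrable J := by
  intro α hα hαJ x v w
  have hx := mem_chart_source E x
  have h := extDeriv_noZeroTwoPart (α := α.inChart x) ((hJ x).differentiableAt (by simp))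
    (((hα x).contDiffAt (chart_target_mem_nhds x)).differentiableAt (by simp))
    (fun v => by
      obtain ⟨v, rfl⟩ := toChart_surjective hx v
      rw [J.inChart_toChart hx, J.inChart_toChart hx, hJJ, map_neg])
    (by
      filter_upwards [chart_target_mem_nhds x] with q hq v
      rw [α.inChart_apply, α.inChart_apply]
      have := hαJ _ (fromChart x q v)
      rw [← J.fromChart_inChart hq] at this
      convert this using 2
      · ext i; fin_cases i; rfl
      · congr 1
        ext i; fin_cases i; rfl)
    (hN x) (toChart x x v) (toChart x x w)
  rw [J.inChart_toChart hx, J.inChart_toChart hx] at h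
  simpa only [DForm.d_apply, toChart_vec_two] using h

variable [FiniteDimensional ℝ E]

/-- The fundamental form of a smooth almost Hermitian structure is differentiable in charts. -/
theorem differentiableAt_fundamentalForm {g : Metric E M} {J : EndField E M} {θ : DForm E M 2 ℝ}
    (h : IsHermitian g J θ) (x : M) :
    DifferentiableAt ℝ (θ.inChart x) (chartAt E x x) := by
  refine differentiableAt_of_forall_apply fun v => ?_
  -- Regularity of θ is not part of the Hermitian data; it is inherited from θ = g(J·, ·).
  have hJ := ((contMDiffAt_endField_iff J x).1 (h.complex.smooth x)).differentiableAt (by simp)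
  have hg := ((contMDiffAt_bilin_iff g.inner x).1 (g.contMDiff x)).differentiableAt (by simp)
  have : DifferentiableAt ℝ (fun q => bilinInChart g.inner x q (J.inChart x q (v 0)) (v 1))
      (chartAt E x x) :=
    (hg.clm_apply (hJ.clm_apply (differentiableAt_const _))).clm_apply (differentiableAt_const _)
  refine this.congr_of_eventuallyEq ?_
  filter_upwards [chart_target_mem_nhds x] with q hq
  have h1 := h.fundamental _ (fromChart x q (v 0)) (fromChart x q (v 1))
  rw [← J.fromChart_inChart hq] at h1
  rw [DForm.inChart_apply]
  refine Eq.trans ?_ h1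
  congr 1
  ext i; fin_cases i <;> rfl

end ChartCalculus

/-! ### Pullbacks in charts -/

section MapsInCharts

variable {E : Type*} [NormedAddCommGroup E] [NormedSpace ℝ E]
  {M : Type*} [TopologicalSpace M] [ChartedSpace E M] [IsManifold 𝓘(ℝ, E) ∞ M]
  {E' : Type*} [NormedAddCommGroup E'] [NormedSpace ℝ E']
  {P : Type*} [TopologicalSpace P] [ChartedSpace E' P] [IsManifold 𝓘(ℝ, E') ∞ P]
  {F : Type*} [NormedAddCommGroup F] [NormedSpace ℝ F]

/-- The expression of a map in the preferred charts at `p` and its image. -/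
def mapInChart (E E' : Type*) [NormedAddCommGroup E] [NormedAddCommGroup E']
    [ChartedSpace E M] [ChartedSpace E' P] (f : P → M) (p : P) : E' → E :=
  chartAt E (f p) ∘ f ∘ (chartAt E' p).symm

/-- The points at which the expression of a map in charts is meaningful. -/
def chartDomain (E E' : Type*) [NormedAddCommGroup E] [NormedAddCommGroup E']
    [ChartedSpace E M] [ChartedSpace E' P] (f : P → M) (p : P) : Set E' :=
  {q | q ∈ (chartAt E' p).target ∧ f ((chartAt E' p).symm q) ∈ (chartAt E (f p)).source}

variable {f : P → M} {p : P} {q : E'}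

omit [IsManifold 𝓘(ℝ, E) ∞ M] [IsManifold 𝓘(ℝ, E') ∞ P] in
theorem chartDomain_mem_nhds (hf : ContMDiff 𝓘(ℝ, E') 𝓘(ℝ, E) ∞ f) (p : P) :
    chartDomain E E' f p ∈ 𝓝 (chartAt E' p p) := by
  have hc : ContinuousAt (f ∘ (chartAt E' p).symm) (chartAt E' p p) :=
    hf.continuous.continuousAt.comp
      ((chartAt E' p).continuousAt_symm (mem_chart_target E' p))
  have hs : (chartAt E (f p)).source ∈ 𝓝 ((f ∘ (chartAt E' p).symm) (chartAt E' p p)) := by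
    rw [Function.comp_apply, (chartAt E' p).left_inv (mem_chart_source E' p)]
    exact (chartAt E (f p)).open_source.mem_nhds (mem_chart_source E (f p))
  filter_upwards [chart_target_mem_nhds p, hc hs] with q h1 h2 using ⟨h1, h2⟩

theorem contDiffAt_mapInChart (hf : ContMDiff 𝓘(ℝ, E') 𝓘(ℝ, E) ∞ f)
    (hq : q ∈ chartDomain E E' f p) : ContDiffAt ℝ ∞ (mapInChart E E' f p) q := by
  rw [← contMDiffAt_iff_contDiffAt]
  have h1 : ContMDiffAt 𝓘(ℝ, E') 𝓘(ℝ, E') ∞ (chartAt E' p).symm q :=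
    (contMDiffOn_chart_symm (I := 𝓘(ℝ, E'))).contMDiffAt
      ((chartAt E' p).open_target.mem_nhds hq.1)
  have h3 : ContMDiffAt 𝓘(ℝ, E) 𝓘(ℝ, E) ∞ (chartAt E (f p)) (f ((chartAt E' p).symm q)) :=
    (contMDiffOn_chart (I := 𝓘(ℝ, E))).contMDiffAt
      ((chartAt E (f p)).open_source.mem_nhds hq.2)
  exact h3.comp q (hf.contMDiffAt.comp q h1)

theorem fderiv_mapInChart (hf : ContMDiff 𝓘(ℝ, E') 𝓘(ℝ, E) ∞ f)
    (hq : q ∈ chartDomain E E' f p) (v : E') :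
    fderiv ℝ (mapInChart E E' f p) q v = toChart (f p) (f ((chartAt E' p).symm q))
      (mfderiv 𝓘(ℝ, E') 𝓘(ℝ, E) f ((chartAt E' p).symm q) (fromChart p q v)) := by
  have h1 : MDifferentiableAt 𝓘(ℝ, E') 𝓘(ℝ, E') (chartAt E' p).symm q :=
    (mdifferentiable_chart (I := 𝓘(ℝ, E')) p).mdifferentiableAt_symm hq.1
  have h2 : MDifferentiableAt 𝓘(ℝ, E') 𝓘(ℝ, E) f ((chartAt E' p).symm q) :=
    hf.mdifferentiableAt (by simp)
  have h3 : MDifferentiableAt 𝓘(ℝ, E) 𝓘(ℝ, E) (chartAt E (f p)) (f ((chartAt E' p).symm q)) :=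
    (mdifferentiable_chart (I := 𝓘(ℝ, E)) (f p)).mdifferentiableAt hq.2
  rw [← mfderiv_eq_fderiv]
  have h := h3.hasMFDerivAt.comp q (h2.hasMFDerivAt.comp q h1.hasMFDerivAt)
  exact congrArg (fun L => L v) h.mfderiv

omit [IsManifold 𝓘(ℝ, E) ∞ M] [IsManifold 𝓘(ℝ, E') ∞ P] in
theorem DForm.pullback_inChart_apply {k : ℕ} (θ : DForm E M k F) (f : P → M) (p : P) (q : E')
    (v : Fin k → E') :
    (θ.pullback f : DForm E' P k F).inChart p q v = θ (f ((chartAt E' p).symm q)) (fun i =>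
      mfderiv 𝓘(ℝ, E') 𝓘(ℝ, E) f ((chartAt E' p).symm q) (fromChart p q (v i))) := rfl

theorem DForm.pullback_inChart {k : ℕ} (θ : DForm E M k F)
    (hf : ContMDiff 𝓘(ℝ, E') 𝓘(ℝ, E) ∞ f) (hq : q ∈ chartDomain E E' f p) :
    (θ.pullback f : DForm E' P k F).inChart p q =
      (θ.inChart (f p) (mapInChart E E' f p q)).compContinuousLinearMap
        (fderiv ℝ (mapInChart E E' f p) q) := by
  ext v
  rw [DForm.pullback_inChart_apply, ← DForm.inChart_toChart θ hq.2]
  change _ = θ.inChart (f p) (mapInChart E E' f p q) (fun i => fderiv ℝ (mapInChart E E' f p) q (v i))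
  simp only [fderiv_mapInChart hf hq]
  rfl

omit [NormedSpace ℝ E] [IsManifold 𝓘(ℝ, E) ∞ M] [NormedSpace ℝ E']
  [IsManifold 𝓘(ℝ, E') ∞ P] in
theorem mapInChart_self (f : P → M) (p : P) :
    mapInChart E E' f p (chartAt E' p p) = chartAt E (f p) (f p) := by
  simp [mapInChart]

theorem differentiableAt_pullback_inChart {k : ℕ} {θ : DForm E M k F}
    (hf : ContMDiff 𝓘(ℝ, E') 𝓘(ℝ, E) ∞ f)
    (hθ : DifferentiableAt ℝ (θ.inChart (f p)) (chartAt E (f p) (f p))) :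
    DifferentiableAt ℝ ((θ.pullback f : DForm E' P k F).inChart p) (chartAt E' p p) := by
  have hp := chartDomain_mem_nhds (E := E) hf p
  have hc := contDiffAt_mapInChart (E := E) hf (mem_of_mem_nhds hp)
  have h1 : DifferentiableAt ℝ (fun q => θ.inChart (f p) (mapInChart E E' f p q))
      (chartAt E' p p) := by
    rw [← mapInChart_self (E' := E')] at hθ
    exact hθ.comp (chartAt E' p p) (hc.differentiableAt (by simp))
  refine (h1.continuousAlternatingMapCompContinuousLinearMap
    ((hc.fderiv_right (m := 1) (by norm_cast)).differentiableAt (by simp))).congr_of_eventuallyEq ?_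
  filter_upwards [hp] with q hq using θ.pullback_inChart hf hq

/-- Near p the pullback is the pullback by the smooth coordinate expression of f, with which d
commutes. -/
theorem extDeriv_pullback_inChart_eq_zero {k : ℕ} {θ : DForm E M k F}
    (hf : ContMDiff 𝓘(ℝ, E') 𝓘(ℝ, E) ∞ f)
    (hθ : DifferentiableAt ℝ (θ.inChart (f p)) (chartAt E (f p) (f p)))
    (hd : extDeriv (θ.inChart (f p)) (chartAt E (f p) (f p)) = 0) :
    extDeriv ((θ.pullback f : DForm E' P k F).inChart p) (chartAt E' p p) = 0 := by
  have hp := chartDomain_mem_nhds (E := E) hf p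
  have hc := contDiffAt_mapInChart (E := E) hf (mem_of_mem_nhds hp)
  have he : (θ.pullback f : DForm E' P k F).inChart p =ᶠ[𝓝 (chartAt E' p p)] fun q =>
      (θ.inChart (f p) (mapInChart E E' f p q)).compContinuousLinearMap
        (fderiv ℝ (mapInChart E E' f p) q) := by
    filter_upwards [hp] with q hq using θ.pullback_inChart hf hq
  rw [← mapInChart_self (E' := E')] at hθ hd
  rw [he.extDeriv_eq, extDeriv_pullback hθ hc (by simp; norm_cast), hd]
  rfl

end MapsInCharts

/-! ### Linear algebra of quaternionic structures -/

section Quaternions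

variable {V : Type*} [AddCommGroup V] [Module ℝ V] [TopologicalSpace V]
  [IsTopologicalAddGroup V] [ContinuousSMul ℝ V]

/-- Three endomorphisms satisfying the quaternion relations. -/
structure IsQuaternionic (I : Fin 3 → V →L[ℝ] V) : Prop where
  sq : ∀ i v, I i (I i v) = -v
  mul_eq : ∀ i v, I i (I (i + 1) v) = I (i + 2) v
  anticomm : ∀ i v, I i (I (i + 1) v) = -(I (i + 1) (I i v))

/-- The combination `a I₁ + b I₂ + c I₃`. -/
def quatComb (I : Fin 3 → V →L[ℝ] V) (a b c : ℝ) : V →L[ℝ] V := a • I 0 + b • I 1 + c • I 2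

/-- The product of two imaginary quaternions is minus their scalar product plus their cross product.
-/
theorem IsQuaternionic.comb_comb {I : Fin 3 → V →L[ℝ] V} (h : IsQuaternionic I)
    (a b c a' b' c' : ℝ) (v : V) :
    quatComb I a b c (quatComb I a' b' c' v) = (-(a * a' + b * b' + c * c')) • v
      + quatComb I (b * c' - c * b') (c * a' - a * c') (a * b' - b * a') v := by
  have h01 : I 0 (I 1 v) = I 2 v := h.mul_eq 0 v
  have h12 : I 1 (I 2 v) = I 0 v := h.mul_eq 1 v
  have h20 : I 2 (I 0 v) = I 1 v := h.mul_eq 2 v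
  have h10 : I 1 (I 0 v) = - I 2 v := by
    rw [← h01]; exact (neg_eq_iff_eq_neg.2 (h.anticomm 0 v)).symm
  have h21 : I 2 (I 1 v) = - I 0 v := by
    rw [← h12]; exact (neg_eq_iff_eq_neg.2 (h.anticomm 1 v)).symm
  have h02 : I 0 (I 2 v) = - I 1 v := by
    rw [← h20]; exact (neg_eq_iff_eq_neg.2 (h.anticomm 2 v)).symm
  simp only [quatComb, add_apply, smul_apply, map_add, map_smul, h.sq, h01, h12, h20, h10, h21,
    h02]
  module

theorem IsQuaternionic.comb_sq {I : Fin 3 → V →L[ℝ] V} (h : IsQuaternionic I)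
    {a b c : ℝ} (habc : a ^ 2 + b ^ 2 + c ^ 2 = 1) (v : V) :
    quatComb I a b c (quatComb I a b c v) = -v := by
  rw [h.comb_comb]
  have e : -(a * a + b * b + c * c) = -1 := by rw [← habc]; ring
  rw [e, mul_comm b c, mul_comm c a, mul_comm a b]
  simp [quatComb]

/-- A unit vector can be completed to an orthonormal pair. -/
theorem exists_orthogonal_unit (a b c : ℝ) :
    ∃ a' b' c' : ℝ, a' ^ 2 + b' ^ 2 + c' ^ 2 = 1 ∧ a * a' + b * b' + c * c' = 0 := by
  -- Off the third axis, (a, b) is normalised and turned by a right angle; on it, the first basis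
  -- vector serves.
  by_cases h : a ^ 2 + b ^ 2 = 0
  · have ha : a = 0 := by nlinarith [sq_nonneg a, sq_nonneg b]
    exact ⟨1, 0, 0, by norm_num, by simp [ha]⟩
  · have h0 : 0 < a ^ 2 + b ^ 2 := lt_of_le_of_ne (by positivity) (Ne.symm h)
    have hr := Real.sq_sqrt h0.le
    have hr0 : Real.sqrt (a ^ 2 + b ^ 2) ≠ 0 := (Real.sqrt_pos.2 h0).ne'
    refine ⟨-b / Real.sqrt (a ^ 2 + b ^ 2), a / Real.sqrt (a ^ 2 + b ^ 2), 0, ?_, ?_⟩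
    · rw [div_pow, div_pow, hr]
      field_simp
      ring
    · field_simp
      ring

variable {B : V →L[ℝ] V →L[ℝ] ℝ} {I : Fin 3 → V →L[ℝ] V}

/-- Each I_i is an isometry of square -1, hence skew; skewness, unlike being an isometry, is linear
in the endomorphism and so passes to combinations. -/
theorem IsQuaternionic.comb_skew (h : IsQuaternionic I)
    (hB : ∀ i v w, B (I i v) (I i w) = B v w) (a b c : ℝ) (v w : V) :
    B (quatComb I a b c v) w = - B v (quatComb I a b c w) := by
  have hi : ∀ i, B (I i v) w = - B v (I i w) := fun i => by
    have := hB i v (I i w)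
    rw [h.sq, map_neg] at this
    linarith
  simp only [quatComb, add_apply, smul_apply, map_add, map_smul, hi]
  simp only [smul_eq_mul]
  ring

theorem IsQuaternionic.comb_isometry (h : IsQuaternionic I)
    (hB : ∀ i v w, B (I i v) (I i w) = B v w) {a b c : ℝ} (habc : a ^ 2 + b ^ 2 + c ^ 2 = 1)
    (v w : V) : B (quatComb I a b c v) (quatComb I a b c w) = B v w := by
  rw [h.comb_skew hB, h.comb_sq habc]
  simp

/-- Left multiplication by the imaginary units on the quaternions. -/
def quatMul : Fin 3 → (Fin 4 → ℝ) →L[ℝ] (Fin 4 → ℝ) :=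
  ![.pi ![-.proj 1, .proj 0, -.proj 3, .proj 2],
    .pi ![-.proj 2, .proj 3, .proj 0, -.proj 1],
    .pi ![-.proj 3, -.proj 2, .proj 1, .proj 0]]

theorem quatMul_zero_apply (x : Fin 4 → ℝ) : quatMul 0 x = ![-x 1, x 0, -x 3, x 2] := by
  ext i; fin_cases i <;> rfl

theorem quatMul_one_apply (x : Fin 4 → ℝ) : quatMul 1 x = ![-x 2, x 3, x 0, -x 1] := by
  ext i; fin_cases i <;> rfl

theorem quatMul_two_apply (x : Fin 4 → ℝ) : quatMul 2 x = ![-x 3, -x 2, x 1, x 0] := by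
  ext i; fin_cases i <;> rfl

theorem isQuaternionic_quatMul : IsQuaternionic quatMul where
  sq i x := by
    fin_cases i <;> ext j <;> fin_cases j <;>
      simp [quatMul_zero_apply, quatMul_one_apply, quatMul_two_apply]
  mul_eq i x := by
    fin_cases i <;> ext j <;> fin_cases j <;>
      simp [quatMul_zero_apply, quatMul_one_apply, quatMul_two_apply]
  anticomm i x := by
    fin_cases i <;> ext j <;> fin_cases j <;>
      simp [quatMul_zero_apply, quatMul_one_apply, quatMul_two_apply]

/-- The coordinate covectors of `ℝ⁴`. -/
def coordForm (i : Fin 4) : (Fin 4 → ℝ) [⋀^Fin 1]→L[ℝ] ℝ :=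
  ContinuousAlternatingMap.ofSubsingleton ℝ (Fin 4 → ℝ) ℝ 0 (.proj i)

theorem coordForm_apply (i : Fin 4) (x : Fin 4 → ℝ) : coordForm i ![x] = x i := rfl

/-- The self-dual two-forms on `ℝ⁴`. -/
def fibreForm : Fin 3 → (Fin 4 → ℝ) [⋀^Fin 2]→L[ℝ] ℝ :=
  ![wedge (coordForm 0) (coordForm 1) + wedge (coordForm 2) (coordForm 3),
    wedge (coordForm 0) (coordForm 2) + wedge (coordForm 3) (coordForm 1),
    wedge (coordForm 0) (coordForm 3) + wedge (coordForm 1) (coordForm 2)]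

/-- This fixes the signs: the forms ν₁ ∧ ν₂ + ν₃ ∧ ν₄ and its companions are the fundamental forms
of left, not right, quaternion multiplication. -/
theorem fibreForm_apply (i : Fin 3) (x y : Fin 4 → ℝ) :
    fibreForm i ![x, y] = ∑ j, quatMul i x j * y j := by
  have hadd : ∀ (α β : (Fin 4 → ℝ) [⋀^Fin 2]→L[ℝ] ℝ),
      (α + β) ![x, y] = α ![x, y] + β ![x, y] := fun _ _ => rfl
  fin_cases i
  · change (wedge (coordForm 0) (coordForm 1) + wedge (coordForm 2) (coordForm 3)) ![x, y]
      = ∑ j, quatMul 0 x j * y j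
    rw [hadd, wedge_one_one_apply, wedge_one_one_apply, quatMul_zero_apply, Fin.sum_univ_four]
    simp [coordForm_apply]
    ring
  · change (wedge (coordForm 0) (coordForm 2) + wedge (coordForm 3) (coordForm 1)) ![x, y]
      = ∑ j, quatMul 1 x j * y j
    rw [hadd, wedge_one_one_apply, wedge_one_one_apply, quatMul_one_apply, Fin.sum_univ_four]
    simp [coordForm_apply]
    ring
  · change (wedge (coordForm 0) (coordForm 3) + wedge (coordForm 1) (coordForm 2)) ![x, y]
      = ∑ j, quatMul 2 x j * y j
    rw [hadd, wedge_one_one_apply, wedge_one_one_apply, quatMul_two_apply, Fin.sum_univ_four]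
    simp [coordForm_apply]
    ring

theorem quatMul_isometry (i : Fin 3) (x y : Fin 4 → ℝ) :
    ∑ j, quatMul i x j * quatMul i y j = ∑ j, x j * y j := by
  fin_cases i <;>
    simp [quatMul_zero_apply, quatMul_one_apply, quatMul_two_apply, Fin.sum_univ_four] <;> ring

end Quaternions

/-! ### Transport of endomorphisms through a splitting -/

section Framing

variable {V W U : Type*} [AddCommGroup V] [Module ℝ V] [TopologicalSpace V]
  [AddCommGroup W] [Module ℝ W] [TopologicalSpace W]
  [AddCommGroup U] [Module ℝ U] [TopologicalSpace U]

/-- The endomorphism which corresponds to `A × K` under the isomorphism `Φ`. -/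
def liftEnd (Φ : V →L[ℝ] W × U) (A : W →L[ℝ] W) (K : U →L[ℝ] U) : V →L[ℝ] V :=
  Φ.inverse ∘L A.prodMap K ∘L Φ

theorem map_liftEnd {Φ : V →L[ℝ] W × U} (hΦ : Φ.IsInvertible) (A : W →L[ℝ] W) (K : U →L[ℝ] U)
    (v : V) : Φ (liftEnd Φ A K v) = (A (Φ v).1, K (Φ v).2) := by
  rw [liftEnd, ContinuousLinearMap.comp_apply, hΦ.self_apply_inverse]
  rfl

theorem IsQuaternionic.liftEnd {Φ : V →L[ℝ] W × U} (hΦ : Φ.IsInvertible)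
    {A : Fin 3 → W →L[ℝ] W} {K : Fin 3 → U →L[ℝ] U} (hA : IsQuaternionic A)
    (hK : IsQuaternionic K) :
    IsQuaternionic (fun i => BalancedTorusBundle.liftEnd Φ (A i) (K i)) where
  sq i v := hΦ.injective (by
    rw [map_liftEnd hΦ, map_liftEnd hΦ, hA.sq, hK.sq, map_neg]; rfl)
  mul_eq i v := hΦ.injective (by
    rw [map_liftEnd hΦ, map_liftEnd hΦ, map_liftEnd hΦ, hA.mul_eq, hK.mul_eq])
  anticomm i v := hΦ.injective (by
    rw [map_neg, map_liftEnd hΦ, map_liftEnd hΦ, map_liftEnd hΦ, map_liftEnd hΦ, hA.anticomm,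
      hK.anticomm]
    rfl)

variable [IsTopologicalAddGroup V] [ContinuousSMul ℝ V]
  [IsTopologicalAddGroup W] [ContinuousSMul ℝ W] [IsTopologicalAddGroup U] [ContinuousSMul ℝ U]

theorem map_quatComb_liftEnd {Φ : V →L[ℝ] W × U} (hΦ : Φ.IsInvertible)
    (A : Fin 3 → W →L[ℝ] W) (K : Fin 3 → U →L[ℝ] U) (a b c : ℝ) (v : V) :
    Φ (quatComb (fun i => liftEnd Φ (A i) (K i)) a b c v)
      = (quatComb A a b c (Φ v).1, quatComb K a b c (Φ v).2) := by
  simp only [quatComb, add_apply, smul_apply, map_add, map_smul, map_liftEnd hΦ]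
  rfl

end Framing

theorem isInvertible_of_surjective {V W : Type*} [NormedAddCommGroup V] [NormedSpace ℝ V]
    [NormedAddCommGroup W] [NormedSpace ℝ W] [FiniteDimensional ℝ V] [FiniteDimensional ℝ W]
    (h : Module.finrank ℝ V = Module.finrank ℝ W) {L : V →L[ℝ] W}
    (hL : Function.Surjective L) : L.IsInvertible := by
  have hi : Function.Injective L.toLinearMap :=
    (LinearMap.injective_iff_surjective_of_finrank_eq_finrank h).2 hL
  exact ⟨(LinearEquiv.ofBijective L.toLinearMap ⟨hi, hL⟩).toContinuousLinearEquiv, by ext; rfl⟩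

theorem isInvertible_of_injective {V W : Type*} [NormedAddCommGroup V] [NormedSpace ℝ V]
    [NormedAddCommGroup W] [NormedSpace ℝ W] [FiniteDimensional ℝ V] [FiniteDimensional ℝ W]
    (h : Module.finrank ℝ V = Module.finrank ℝ W) {L : V →L[ℝ] W}
    (hL : Function.Injective L) : L.IsInvertible :=
  isInvertible_of_surjective h
    ((LinearMap.injective_iff_surjective_of_finrank_eq_finrank (f := L.toLinearMap) h).1 hL)

/-! ### Horizontal and vertical components on the torus bundle -/

section Bundle

variable {E : Type*} [NormedAddCommGroup E] [NormedSpace ℝ E]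
  {E' : Type*} [NormedAddCommGroup E'] [NormedSpace ℝ E']
  {M : Type*} [TopologicalSpace M] [ChartedSpace E M]
  {P : Type*} [TopologicalSpace P] [ChartedSpace E' P]

/-- The `ℝ⁴`-valued connection form with components `ν i`. -/
def connMap (ν : Fin 4 → DForm E' P 1 ℝ) (p : P) :
    TangentSpace 𝓘(ℝ, E') p →L[ℝ] (Fin 4 → ℝ) :=
  .pi fun i => (ContinuousAlternatingMap.ofSubsingleton ℝ (TangentSpace 𝓘(ℝ, E') p) ℝ
    (0 : Fin 1)).symm (ν i p)

theorem connMap_apply (ν : Fin 4 → DForm E' P 1 ℝ) (p : P) (v : TangentSpace 𝓘(ℝ, E') p)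
    (i : Fin 4) : connMap ν p v i = ν i p ![v] :=
  congrArg (ν i p) (by ext i; fin_cases i; rfl)

/-- The horizontal and vertical components of tangent vectors. -/
def splitting (E : Type*) [NormedAddCommGroup E] [NormedSpace ℝ E] [ChartedSpace E M]
    (π : P → M) (ν : Fin 4 → DForm E' P 1 ℝ) (p : P) :
    TangentSpace 𝓘(ℝ, E') p →L[ℝ] TangentSpace 𝓘(ℝ, E) (π p) × (Fin 4 → ℝ) :=
  (mfderiv 𝓘(ℝ, E') 𝓘(ℝ, E) π p).prod (connMap ν p)

variable [MulAction T4 P] {π : P → M} {ν : Fin 4 → DForm E' P 1 ℝ}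

/-- A local trivialization gives a smooth local section through p, whose derivative is a right
inverse. -/
theorem IsPrincipalT4Bundle.mfderiv_surjective
    (hπ : IsPrincipalT4Bundle (E := E) (E' := E') π) (p : P) :
    Function.Surjective (mfderiv 𝓘(ℝ, E') 𝓘(ℝ, E) π p) := by
  obtain ⟨U, hU, hpU, e, hsrc, htgt, -, hsymm, heq⟩ := hπ.locally_trivial (π p)
  have hp : p ∈ e.source := by rw [hsrc]; exact hpU
  set s : M → P := fun y => e.symm (y, (e p).2) with hs
  have hsp : s (π p) = p := by
    have : e p = (π p, (e p).2) := Prod.ext (heq p hp).1 rfl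
    rw [hs]
    simp only
    rw [← this, e.left_inv hp]
  have hps : ∀ᶠ y in 𝓝 (π p), (π ∘ s) y = y := by
    filter_upwards [hU.mem_nhds hpU] with y hy
    have hy' : (y, (e p).2) ∈ e.target := by rw [htgt]; exact ⟨hy, trivial⟩
    have := (heq _ (e.map_target hy')).1
    rw [e.right_inv hy'] at this
    exact this.symm
  have hsd : MDifferentiableAt 𝓘(ℝ, E) 𝓘(ℝ, E') s (π p) := by
    have ht : e.target ∈ 𝓝 (π p, (e p).2) := e.open_target.mem_nhds (by
      rw [htgt]; exact ⟨hpU, trivial⟩)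
    have h1 : ContMDiffAt (𝓘(ℝ, E).prod T4Model) 𝓘(ℝ, E') ∞ e.symm (π p, (e p).2) :=
      hsymm.contMDiffAt ht
    have h2 : ContMDiffAt 𝓘(ℝ, E) (𝓘(ℝ, E).prod T4Model) ∞ (fun y : M => (y, (e p).2)) (π p) :=
      contMDiffAt_id.prodMk contMDiffAt_const
    exact (ContMDiffAt.comp (π p) h1 h2).mdifferentiableAt (by simp)
  have hπd : MDifferentiableAt 𝓘(ℝ, E') 𝓘(ℝ, E) π (s (π p)) :=
    hπ.smooth_proj.mdifferentiableAt (by simp)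
  have hcomp := hπd.hasMFDerivAt.comp (π p) hsd.hasMFDerivAt
  have hid : HasMFDerivAt 𝓘(ℝ, E) 𝓘(ℝ, E) (π ∘ s) (π p)
      (ContinuousLinearMap.id ℝ (TangentSpace 𝓘(ℝ, E) (π p))) :=
    (hasMFDerivAt_id (π p)).congr_of_eventuallyEq hps
  have h := hasMFDerivAt_unique hcomp hid
  intro w
  have hw := congrArg (fun L => L w) h
  rw [← hsp]
  exact ⟨_, hw⟩

theorem IsPrincipalT4Bundle.mfderiv_fundamentalField
    (hπ : IsPrincipalT4Bundle (E := E) (E' := E') π) (j : Fin 4) (p : P) :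
    mfderiv 𝓘(ℝ, E') 𝓘(ℝ, E) π p (fundamentalField j p) = 0 := by
  set u : ℝ → P := fun t => T4.exp (Pi.single j t) • p with hu
  have hu0 : u 0 = p := by
    have : T4.exp (Pi.single j 0) = 1 := by simp [T4.exp]
    rw [hu]
    simp only [this, one_smul]
  change mfderiv 𝓘(ℝ, E') 𝓘(ℝ, E) π p (mfderiv 𝓘(ℝ, ℝ) 𝓘(ℝ, E') u 0 (1 : ℝ)) = 0
  -- If the orbit curve is differentiable, π is constant along it; otherwise the fundamental vector
  -- is 0, the default value of `mfderiv`.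
  by_cases h : MDifferentiableAt 𝓘(ℝ, ℝ) 𝓘(ℝ, E') u 0
  · have hπd : MDifferentiableAt 𝓘(ℝ, E') 𝓘(ℝ, E) π (u 0) :=
      hπ.smooth_proj.mdifferentiableAt (by simp)
    have hcomp := hπd.hasMFDerivAt.comp (0 : ℝ) h.hasMFDerivAt
    have hc : π ∘ u = fun _ => π p := by
      ext t
      exact hπ.proj_smul _ _
    have hid : HasMFDerivAt 𝓘(ℝ, ℝ) 𝓘(ℝ, E) (π ∘ u) 0 0 := by
      rw [hc]; exact hasMFDerivAt_const _ _
    have := congrArg (fun L => L (1 : ℝ)) (hasMFDerivAt_unique hcomp hid)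
    rw [hu0] at this
    exact this
  · rw [mfderiv_zero_of_not_mdifferentiableAt h]
    exact map_zero _

theorem IsPrincipalT4Bundle.splitting_isInvertible [FiniteDimensional ℝ E]
    [FiniteDimensional ℝ E'] (hE : Module.finrank ℝ E' = Module.finrank ℝ E + 4)
    (hπ : IsPrincipalT4Bundle (E := E) (E' := E') π) (hν : IsConnection ν) (p : P) :
    (splitting E π ν p).IsInvertible := by
  have hs : Function.Surjective (splitting E π ν p) := by
    rintro ⟨w, u⟩
    obtain ⟨v, rfl⟩ := hπ.mfderiv_surjective p w
    -- Any lift of w, corrected by fundamental vectors: dπ kills them and ν takes the standard basis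
    -- values on them. Equality of dimensions then gives invertibility.
    refine ⟨v + ∑ j, (u j - connMap ν p v j) • fundamentalField j p, Prod.ext ?_ ?_⟩
    · change mfderiv 𝓘(ℝ, E') 𝓘(ℝ, E) π p _ = _
      rw [map_add, map_sum]
      simp [hπ.mfderiv_fundamentalField]
    · change connMap ν p _ = _
      ext i
      rw [map_add, map_sum]
      simp [connMap_apply, hν.vertical]
  exact isInvertible_of_surjective (V := E') (W := E × (Fin 4 → ℝ)) (by simp [hE]) hs

end Bundle

/-! ### Smoothness of the lifted structures and the metric on P -/

section Smooth

theorem contDiffAt_of_forall_clm_apply {X V W : Type*} [NormedAddCommGroup X] [NormedSpace ℝ X]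
    [NormedAddCommGroup V] [NormedSpace ℝ V] [FiniteDimensional ℝ V]
    [NormedAddCommGroup W] [NormedSpace ℝ W] {f : X → V →L[ℝ] W} {x : X}
    (h : ∀ v, ContDiffAt ℝ ∞ (fun y => f y v) x) : ContDiffAt ℝ ∞ f x := by
  let d := Module.finrank ℝ V
  have hd : d = Module.finrank ℝ (Fin d → ℝ) := (Module.finrank_fin_fun ℝ).symm
  let e₁ := ContinuousLinearEquiv.ofFinrankEq hd
  let e₂ := (e₁.arrowCongr (1 : W ≃L[ℝ] W)).trans (ContinuousLinearEquiv.piRing (Fin d))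
  rw [← Function.id_comp f, ← e₂.symm_comp_self]
  exact e₂.symm.contDiff.contDiffAt.comp x (contDiffAt_pi.mpr fun i => h _)

/-- The unit ball of a positive definite form on a finite-dimensional space is bounded. -/
theorem isVonNBounded_of_pos {V : Type*} [NormedAddCommGroup V] [NormedSpace ℝ V]
    [FiniteDimensional ℝ V] (B : V →L[ℝ] V →L[ℝ] ℝ) (hB : ∀ v, v ≠ 0 → 0 < B v v) :
    Bornology.IsVonNBounded ℝ {v | B v v < 1} := by
  have hc : Continuous fun v => B v v := by fun_prop
  -- m is a positive lower bound of B on the compact unit sphere, so m‖v‖² ≤ B v v for all v.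
  obtain ⟨m, hm, hmB⟩ := (isCompact_sphere (0 : V) 1).exists_forall_le' hc.continuousOn (a := 0)
    (fun v hv => hB v (by rintro rfl; simp at hv))
  rw [NormedSpace.isVonNBounded_iff, isBounded_iff_forall_norm_le]
  -- From ‖v‖² ≤ 1/m and 2‖v‖ ≤ 1 + ‖v‖²; a square root is avoided.
  refine ⟨1 + 1 / m, fun v hv => ?_⟩
  have hv' : B v v < 1 := hv
  rcases eq_or_ne v 0 with rfl | h0
  · rw [norm_zero]; positivity
  have hn : 0 < ‖v‖ := norm_pos_iff.2 h0
  have h1 := hmB (‖v‖⁻¹ • v) (by simp [norm_smul, hn.ne'])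
  simp only [map_smul, smul_apply, smul_eq_mul] at h1
  have h2 : m * ‖v‖ ^ 2 ≤ B v v := by
    have : B v v = ‖v‖⁻¹ * (‖v‖⁻¹ * B v v) * ‖v‖ ^ 2 := by field_simp
    rw [this]; gcongr
  have h3 : ‖v‖ ^ 2 ≤ 1 / m := by rw [le_div_iff₀ hm]; linarith
  nlinarith [sq_nonneg (‖v‖ - 1), one_div_pos.2 hm]

variable {E : Type*} [NormedAddCommGroup E] [NormedSpace ℝ E]
  {E' : Type*} [NormedAddCommGroup E'] [NormedSpace ℝ E']
  {M : Type*} [TopologicalSpace M] [ChartedSpace E M]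
  {P : Type*} [TopologicalSpace P] [ChartedSpace E' P]

/-- The expression of the connection form in the preferred chart at `p`. -/
def connInChart (ν : Fin 4 → DForm E' P 1 ℝ) (p : P) (q : E') : E' →L[ℝ] (Fin 4 → ℝ) :=
  connMap ν ((chartAt E' p).symm q) ∘L fromChart p q

theorem connInChart_apply (ν : Fin 4 → DForm E' P 1 ℝ) (p : P) (q v : E') (i : Fin 4) :
    connInChart ν p q v i = (ν i).inChart p q ![v] :=
  (connMap_apply ν _ _ i).trans (congrArg (ν i _) (by ext i; fin_cases i; rfl))

/-- The expression of `splitting` in charts. -/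
def splittingInChart (E : Type*) [NormedAddCommGroup E] [NormedSpace ℝ E] [ChartedSpace E M]
    (π : P → M) (ν : Fin 4 → DForm E' P 1 ℝ) (p : P) (q : E') : E' →L[ℝ] E × (Fin 4 → ℝ) :=
  (fderiv ℝ (mapInChart E E' π p) q).prod (connInChart ν p q)

variable {π : P → M} {ν : Fin 4 → DForm E' P 1 ℝ} {p : P} {q : E'}

theorem contDiffAt_connInChart [FiniteDimensional ℝ E'] (hν : ∀ i, (ν i).IsSmooth) (p : P) :
    ContDiffAt ℝ ∞ (connInChart ν p) (chartAt E' p p) := by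
  refine contDiffAt_of_forall_clm_apply fun v => contDiffAt_pi.2 fun i => ?_
  simp only [connInChart_apply]
  have h := (hν i p).contDiffAt (chart_target_mem_nhds p)
  let e := (ContinuousAlternatingMap.ofSubsingletonLIE (𝕜 := ℝ) (E := E') (F := ℝ) (0 : Fin 1)).symm
  have h2 : ContDiffAt ℝ ∞ (fun q => e ((ν i).inChart p q) v) (chartAt E' p p) :=
    (e.contDiff.contDiffAt.comp _ h).clm_apply contDiffAt_const
  refine h2.congr_of_eventuallyEq (.of_forall fun q => ?_)
  exact congrArg ((ν i).inChart p q) (by ext i; fin_cases i; rfl)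

variable [IsManifold 𝓘(ℝ, E) ∞ M] [IsManifold 𝓘(ℝ, E') ∞ P]

theorem splittingInChart_apply (hπ : ContMDiff 𝓘(ℝ, E') 𝓘(ℝ, E) ∞ π)
    (hq : q ∈ chartDomain E E' π p) (v : E') :
    splittingInChart E π ν p q v =
      (toChart (π p) (π ((chartAt E' p).symm q))
          (splitting E π ν ((chartAt E' p).symm q) (fromChart p q v)).1,
        (splitting E π ν ((chartAt E' p).symm q) (fromChart p q v)).2) :=
  Prod.ext (fderiv_mapInChart hπ hq v) rfl

theorem contDiffAt_splittingInChart [FiniteDimensional ℝ E']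
    (hπ : ContMDiff 𝓘(ℝ, E') 𝓘(ℝ, E) ∞ π) (hν : ∀ i, (ν i).IsSmooth) (p : P) :
    ContDiffAt ℝ ∞ (splittingInChart E π ν p) (chartAt E' p p) := by
  have h1 := contDiffAt_mapInChart (E := E) hπ (mem_of_mem_nhds (chartDomain_mem_nhds hπ p))
  have h2 := contDiffAt_connInChart hν p
  have h3 : ContDiffAt ℝ ∞ (fderiv ℝ (mapInChart E E' π p)) (chartAt E' p p) :=
    h1.fderiv_right (by simp)
  exact contDiffAt_of_forall_clm_apply fun v =>
    (h3.clm_apply contDiffAt_const).prodMk (h2.clm_apply contDiffAt_const)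

theorem splittingInChart_isInvertible [FiniteDimensional ℝ E]
    [FiniteDimensional ℝ E'] (hE : Module.finrank ℝ E' = Module.finrank ℝ E + 4)
    (hπ : ContMDiff 𝓘(ℝ, E') 𝓘(ℝ, E) ∞ π) (hq : q ∈ chartDomain E E' π p)
    (hΦ : (splitting E π ν ((chartAt E' p).symm q)).IsInvertible) :
    (splittingInChart E π ν p q).IsInvertible := by
  refine isInvertible_of_injective (by simp [hE]) fun v w h => ?_
  rw [splittingInChart_apply hπ hq, splittingInChart_apply hπ hq, Prod.mk.injEq] at h
  have := hΦ.injective (Prod.ext (toChart_injective hq.2 h.1) h.2)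
  rw [← toChart_fromChart hq.1 v, this, toChart_fromChart hq.1 w]

/-- The endomorphism field on `P` which is `A` on horizontal and `K` on vertical vectors. -/
def liftField (π : P → M) (ν : Fin 4 → DForm E' P 1 ℝ) (A : EndField E M)
    (K : (Fin 4 → ℝ) →L[ℝ] (Fin 4 → ℝ)) : EndField E' P :=
  fun p => liftEnd (splitting E π ν p) (A (π p)) K

theorem splittingInChart_endField (hπ : ContMDiff 𝓘(ℝ, E') 𝓘(ℝ, E) ∞ π)
    (hq : q ∈ chartDomain E E' π p) {J : EndField E' P} {A : EndField E M}
    {K : (Fin 4 → ℝ) →L[ℝ] (Fin 4 → ℝ)}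
    (hJ : ∀ p v, splitting E π ν p (J p v)
      = (A (π p) (splitting E π ν p v).1, K (splitting E π ν p v).2)) (v : E') :
    splittingInChart E π ν p q (J.inChart p q v) =
      (A.inChart (π p) (mapInChart E E' π p q) (splittingInChart E π ν p q v).1,
        K (splittingInChart E π ν p q v).2) := by
  simp only [splittingInChart_apply hπ hq, J.fromChart_inChart hq.1, hJ]
  exact Prod.ext (A.inChart_toChart hq.2 _).symm rfl

section Lift

variable [FiniteDimensional ℝ E] [FiniteDimensional ℝ E']

/-- In charts J is Ψ⁻¹ ∘ (A × K) ∘ Ψ with Ψ smooth and invertible, and inversion is smooth. Since J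
enters only through the intertwining relation, the lemma applies to all combinations of the Ǐ_i at
once. -/
theorem contDiffAt_lift_inChart (hE : Module.finrank ℝ E' = Module.finrank ℝ E + 4)
    (hπ : ContMDiff 𝓘(ℝ, E') 𝓘(ℝ, E) ∞ π) (hν : ∀ i, (ν i).IsSmooth)
    (hΦ : ∀ p, (splitting E π ν p).IsInvertible) {J : EndField E' P} {A : EndField E M}
    {K : (Fin 4 → ℝ) →L[ℝ] (Fin 4 → ℝ)}
    (hJ : ∀ p v, splitting E π ν p (J p v)
      = (A (π p) (splitting E π ν p v).1, K (splitting E π ν p v).2))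
    (p : P) (hA : ContDiffAt ℝ ∞ (A.inChart (π p)) (chartAt E (π p) (π p))) :
    ContDiffAt ℝ ∞ (J.inChart p) (chartAt E' p p) := by
  have hp := chartDomain_mem_nhds (E := E) hπ p
  have hΨ := contDiffAt_splittingInChart (E := E) hπ hν p
  have hi := (splittingInChart_isInvertible hE hπ (mem_of_mem_nhds hp)
    (hΦ _)).contDiffAt_map_inverse (n := ∞)
  have hinv : ContDiffAt ℝ ∞ (fun q => (splittingInChart E π ν p q).inverse) (chartAt E' p p) :=
    hi.comp (chartAt E' p p) hΨ
  have hc := contDiffAt_mapInChart (E := E) hπ (mem_of_mem_nhds hp)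
  rw [← mapInChart_self (E' := E')] at hA
  have hAc : ContDiffAt ℝ ∞ (fun q => A.inChart (π p) (mapInChart E E' π p q)) (chartAt E' p p) :=
    hA.comp (chartAt E' p p) hc
  have h : ContDiffAt ℝ ∞ (fun q => liftEnd (splittingInChart E π ν p q)
      (A.inChart (π p) (mapInChart E E' π p q)) K) (chartAt E' p p) :=
    contDiffAt_of_forall_clm_apply fun v => by
      have hΨv := hΨ.clm_apply (contDiffAt_const (c := v))
      exact hinv.clm_apply ((hAc.clm_apply hΨv.fst).prodMk
        (K.contDiff.contDiffAt.comp (chartAt E' p p) hΨv.snd))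
  refine h.congr_of_eventuallyEq ?_
  filter_upwards [hp] with q hq
  have hq' := splittingInChart_isInvertible hE hπ hq (hΦ _)
  ext1 v
  apply hq'.injective
  rw [map_liftEnd hq', splittingInChart_endField hπ hq hJ]

end Lift

/-- The bilinear form `π^* g + ν₁² + ν₂² + ν₃² + ν₄²`. -/
def checkInner (g : Metric E M) (π : P → M) (ν : Fin 4 → DForm E' P 1 ℝ) (p : P) :
    TangentSpace 𝓘(ℝ, E') p →L[ℝ] TangentSpace 𝓘(ℝ, E') p →L[ℝ] ℝ :=
  (mfderiv 𝓘(ℝ, E') 𝓘(ℝ, E) π p).precomp ℝ ∘L g.inner (π p) ∘L mfderiv 𝓘(ℝ, E') 𝓘(ℝ, E) π p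
    + ∑ i, (ContinuousLinearMap.proj i ∘L connMap ν p).smulRight
        (ContinuousLinearMap.proj i ∘L connMap ν p)

omit [IsManifold 𝓘(ℝ, E') ∞ P] in
theorem checkInner_apply (g : Metric E M) (π : P → M) (ν : Fin 4 → DForm E' P 1 ℝ) (p : P)
    (v w : TangentSpace 𝓘(ℝ, E') p) :
    checkInner g π ν p v w = g.inner (π p) (splitting E π ν p v).1 (splitting E π ν p w).1
      + ∑ i, (splitting E π ν p v).2 i * (splitting E π ν p w).2 i := by
  simp [checkInner, splitting]

theorem contDiffAt_checkInner_inChart [FiniteDimensional ℝ E'] (g : Metric E M) (hπ : ContMDiff 𝓘(ℝ, E') 𝓘(ℝ, E) ∞ π)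
    (hν : ∀ i, (ν i).IsSmooth) (p : P) :
    ContDiffAt ℝ ∞ (bilinInChart (checkInner g π ν) p) (chartAt E' p p) := by
  have hp := chartDomain_mem_nhds (E := E) hπ p
  have hΨ := contDiffAt_splittingInChart (E := E) hπ hν p
  have hg := (contMDiffAt_bilin_iff g.inner (π p)).1 (g.contMDiff (π p))
  rw [← mapInChart_self (E' := E')] at hg
  have hgc : ContDiffAt ℝ ∞ (fun q => bilinInChart g.inner (π p) (mapInChart E E' π p q))
      (chartAt E' p p) :=
    hg.comp (chartAt E' p p) (contDiffAt_mapInChart (E := E) hπ (mem_of_mem_nhds hp))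
  refine contDiffAt_of_forall_clm_apply fun v => contDiffAt_of_forall_clm_apply fun w => ?_
  have hv := hΨ.clm_apply (contDiffAt_const (c := v))
  have hw := hΨ.clm_apply (contDiffAt_const (c := w))
  have h : ContDiffAt ℝ ∞ (fun q => bilinInChart g.inner (π p) (mapInChart E E' π p q)
      (splittingInChart E π ν p q v).1 (splittingInChart E π ν p q w).1
      + ∑ i, (splittingInChart E π ν p q v).2 i * (splittingInChart E π ν p q w).2 i)
      (chartAt E' p p) :=
    ((hgc.clm_apply hv.fst).clm_apply hw.fst).add (ContDiffAt.sum fun i _ =>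
      (contDiffAt_pi.1 hv.snd i).mul (contDiffAt_pi.1 hw.snd i))
  refine h.congr_of_eventuallyEq ?_
  filter_upwards [hp] with q hq
  refine (checkInner_apply g π ν _ (fromChart p q v) (fromChart p q w)).trans ?_
  simp only [splittingInChart_apply hπ hq]
  exact congrArg (· + _) (bilinInChart_toChart g.inner hq.2 _ _).symm

omit [IsManifold 𝓘(ℝ, E') ∞ P] in
theorem checkInner_pos (g : Metric E M) (hΦ : ∀ p, (splitting E π ν p).IsInvertible) (p : P)
    (v : TangentSpace 𝓘(ℝ, E') p) (hv : v ≠ 0) : 0 < checkInner g π ν p v v := by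
  rw [checkInner_apply]
  have h2 : 0 ≤ ∑ i, (splitting E π ν p v).2 i * (splitting E π ν p v).2 i :=
    Finset.sum_nonneg fun i _ => mul_self_nonneg _
  by_cases h1 : (splitting E π ν p v).1 = 0
  · rw [h1, map_zero]
    refine lt_of_le_of_ne (by simpa using h2) fun h0 => hv ((hΦ p).injective ?_)
    rw [zero_add] at h0
    rw [map_zero]
    refine Prod.ext h1 (funext fun i => ?_)
    have := (Finset.sum_eq_zero_iff_of_nonneg fun i _ => mul_self_nonneg
      ((splitting E π ν p v).2 i)).1 h0.symm i (Finset.mem_univ i)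
    exact mul_self_eq_zero.1 this
  · exact add_pos_of_pos_of_nonneg (g.pos _ _ h1) h2

/-- The Riemannian metric `π^* g + ν₁² + ν₂² + ν₃² + ν₄²`. -/
def checkMetric [FiniteDimensional ℝ E'] (g : Metric E M) (hπ : ContMDiff 𝓘(ℝ, E') 𝓘(ℝ, E) ∞ π)
    (hν : ∀ i, (ν i).IsSmooth) (hΦ : ∀ p, (splitting E π ν p).IsInvertible) : Metric E' P where
  inner := checkInner g π ν
  symm p v w := by
    rw [checkInner_apply, checkInner_apply, g.symm]
    simp only [mul_comm]
  pos := checkInner_pos g hΦ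
  isVonNBounded p := isVonNBounded_of_pos (V := E') (checkInner g π ν p) (checkInner_pos g hΦ p)
  contMDiff p := (contMDiffAt_bilin_iff _ p).2 (contDiffAt_checkInner_inChart g hπ hν p)

theorem checkMetric_isCheckMetric [FiniteDimensional ℝ E'] (g : Metric E M)
    (hπ : ContMDiff 𝓘(ℝ, E') 𝓘(ℝ, E) ∞ π) (hν : ∀ i, (ν i).IsSmooth)
    (hΦ : ∀ p, (splitting E π ν p).IsInvertible) :
    IsCheckMetric π g ν (checkMetric g hπ hν hΦ) := fun p v w => by
  simp only [← connMap_apply]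
  exact checkInner_apply g π ν p v w

end Smooth

/-! ### Combinations of hyper-Hermitian structures -/

section HyperHermitian

variable {E : Type*} [NormedAddCommGroup E] [NormedSpace ℝ E]
  {M : Type*} [TopologicalSpace M] [ChartedSpace E M] [IsManifold 𝓘(ℝ, E) ∞ M]
  {g : Metric E M} {I : Fin 3 → EndField E M} {σ : Fin 3 → DForm E M 2 ℝ}

theorem IsHyperHermitian.isQuaternionic (h : IsHyperHermitian g I σ) (x : M) :
    IsQuaternionic (fun i => I i x) where
  sq i := (h.hermitian i).complex.sq x
  mul_eq i := h.mul_eq i x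
  anticomm i := h.anticomm i x

omit [IsManifold 𝓘(ℝ, E) ∞ M] in
theorem combForm_vec_apply (σ : Fin 3 → DForm E M 2 ℝ) (a b c : ℝ) (x : M)
    (v : Fin 2 → TangentSpace 𝓘(ℝ, E) x) :
    combForm σ a b c x v = a * σ 0 x v + b * σ 1 x v + c * σ 2 x v := rfl

omit [IsManifold 𝓘(ℝ, E) ∞ M] in
theorem combJ_apply (I : Fin 3 → EndField E M) (a b c : ℝ) (x : M) (v : TangentSpace 𝓘(ℝ, E) x) :
    combJ I a b c x v = a • I 0 x v + b • I 1 x v + c • I 2 x v := rfl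

theorem IsHyperHermitian.combForm_apply (h : IsHyperHermitian g I σ) (a b c : ℝ) (x : M)
    (v w : TangentSpace 𝓘(ℝ, E) x) :
    combForm σ a b c x ![v, w] = g.inner x (combJ I a b c x v) w := by
  rw [combForm_vec_apply, (h.hermitian 0).fundamental, (h.hermitian 1).fundamental, (h.hermitian 2).fundamental]
  simp [combJ]

theorem IsHyperHermitian.combForm_combJ (h : IsHyperHermitian g I σ) (a b c a' b' c' : ℝ) (x : M)
    (v w : TangentSpace 𝓘(ℝ, E) x) :
    combForm σ a' b' c' x ![combJ I a b c x v, w]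
      = -(a' * a + b' * b + c' * c) * g.inner x v w
        + combForm σ (b' * c - c' * b) (c' * a - a' * c) (a' * b - b' * a) x ![v, w] := by
  rw [h.combForm_apply, h.combForm_apply]
  have := (h.isQuaternionic x).comb_comb a' b' c' a b c v
  change combJ I a' b' c' x (combJ I a b c x v) = _ • v + combJ I _ _ _ x v at this
  rw [this, map_add, map_smul]
  rfl

theorem IsHyperHermitian.combJ_sq (h : IsHyperHermitian g I σ) {a b c : ℝ}
    (habc : a ^ 2 + b ^ 2 + c ^ 2 = 1) (x : M) (v : TangentSpace 𝓘(ℝ, E) x) :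
    combJ I a b c x (combJ I a b c x v) = -v :=
  (h.isQuaternionic x).comb_sq habc v

theorem IsHyperHermitian.combJ_isometry (h : IsHyperHermitian g I σ) {a b c : ℝ}
    (habc : a ^ 2 + b ^ 2 + c ^ 2 = 1) (x : M) (v w : TangentSpace 𝓘(ℝ, E) x) :
    g.inner x (combJ I a b c x v) (combJ I a b c x w) = g.inner x v w :=
  (h.isQuaternionic x).comb_isometry (fun i => (h.hermitian i).compatible x) habc v w

/-- For orthogonal u and u', J_u and J_{u'} anticommute and J_{u'} is an isometry. This is the sign
reversal used in the balanced condition. -/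
theorem IsHyperHermitian.combForm_combJ_combJ (h : IsHyperHermitian g I σ) {a b c a' b' c' : ℝ}
    (h' : a' ^ 2 + b' ^ 2 + c' ^ 2 = 1) (ho : a * a' + b * b' + c * c' = 0) (x : M)
    (v w : TangentSpace 𝓘(ℝ, E) x) :
    combForm σ a b c x ![combJ I a' b' c' x v, combJ I a' b' c' x w]
      = -combForm σ a b c x ![v, w] := by
  -- Triple products: (u × u') · u' = 0 and (u × u') × u' = -u.
  have e : (b * c' - c * b') * a' + (c * a' - a * c') * b' + (a * b' - b * a') * c' = 0 := by ring
  have e₁ : (c * a' - a * c') * c' - (a * b' - b * a') * b' = -a := by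
    linear_combination a' * ho - a * h'
  have e₂ : (a * b' - b * a') * a' - (b * c' - c * b') * c' = -b := by
    linear_combination b' * ho - b * h'
  have e₃ : (b * c' - c * b') * b' - (c * a' - a * c') * a' = -c := by
    linear_combination c' * ho - c * h'
  have hs : ∀ (θ : DForm E M 2 ℝ) (v w : TangentSpace 𝓘(ℝ, E) x), θ x ![w, v] = -θ x ![v, w] :=
    fun θ => form_smul_two (V := E) (θ x)
  rw [h.combForm_combJ, ho, hs, h.combForm_combJ, e, e₁, e₂, e₃, hs _ v w]
  simp only [combForm_vec_apply]
  ring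

omit [IsManifold 𝓘(ℝ, E) ∞ M] in
theorem combJ_inChart (I : Fin 3 → EndField E M) (a b c : ℝ) (x : M) (q : E) :
    (combJ I a b c).inChart x q
      = a • (I 0).inChart x q + b • (I 1).inChart x q + c • (I 2).inChart x q := by
  ext v
  simp [EndField.inChart, combJ]

theorem IsHyperHermitian.contDiffAt_combJ_inChart (h : IsHyperHermitian g I σ) (a b c : ℝ)
    (x : M) : ContDiffAt ℝ ∞ ((combJ I a b c).inChart x) (chartAt E x x) := by
  have hi := fun i => (contMDiffAt_endField_iff (I i) x).1 ((h.hermitian i).complex.smooth x)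
  refine ((((hi 0).const_smul a).add ((hi 1).const_smul b)).add
    ((hi 2).const_smul c)).congr_of_eventuallyEq (.of_forall fun q => ?_)
  exact combJ_inChart I a b c x q

omit [IsManifold 𝓘(ℝ, E) ∞ M] in
theorem combForm_inChart (σ : Fin 3 → DForm E M 2 ℝ) (a b c : ℝ) (x : M) :
    (combForm σ a b c).inChart x
      = a • (σ 0).inChart x + b • (σ 1).inChart x + c • (σ 2).inChart x := rfl

theorem IsHyperHermitian.differentiableAt_combForm_inChart [FiniteDimensional ℝ E]
    (h : IsHyperHermitian g I σ) (a b c : ℝ) (x : M) :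
    DifferentiableAt ℝ ((combForm σ a b c).inChart x) (chartAt E x x) := by
  have hi := fun i => differentiableAt_fundamentalForm (h.hermitian i) x
  rw [combForm_inChart]
  exact (((hi 0).const_smul a).add ((hi 1).const_smul b)).add ((hi 2).const_smul c)

theorem IsHyperKahler.extDeriv_combForm [FiniteDimensional ℝ E]
    (h : IsHyperKahler g I σ) (a b c : ℝ) (x : M) :
    extDeriv ((combForm σ a b c).inChart x) (chartAt E x x) = 0 := by
  have hi := fun i => differentiableAt_fundamentalForm (h.hyperHermitian.hermitian i) x
  have hd : ∀ i, extDeriv ((σ i).inChart x) (chartAt E x x) = 0 := fun i =>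
    DForm.extDeriv_inChart_eq_zero (congrFun (h.closed i) x)
  rw [combForm_inChart, extDeriv_add (((hi 0).const_smul a).add ((hi 1).const_smul b))
    ((hi 2).const_smul c), extDeriv_add ((hi 0).const_smul a) ((hi 1).const_smul b),
    extDeriv_smul, extDeriv_smul, extDeriv_smul, hd, hd, hd]
  simp

theorem DForm.d_inChart {F : Type*} [NormedAddCommGroup F] [NormedSpace ℝ F] {k : ℕ}
    (θ : DForm E M k F) (x : M) :
    θ.d.inChart x (chartAt E x x) = extDeriv (θ.inChart x) (chartAt E x x) := by
  ext w
  choose v hv using fun i => toChart_surjective (mem_chart_source E x) (w i)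
  have h1 := θ.d.inChart_toChart (mem_chart_source E x) v
  rw [DForm.d_apply] at h1
  simpa only [hv] using h1

-- Wedge powers commute with the linear pullback by the chart, as the permutation formula makes
-- visible.
omit [IsManifold 𝓘(ℝ, E) ∞ M] in
theorem DForm.pow_inChart (θ : DForm E M 2 ℝ) (k : ℕ) (x : M) (q : E) :
    (θ.pow k).inChart x q = wedgePow (θ.inChart x q) k := by
  ext v
  rw [DForm.inChart_apply, DForm.pow, wedgePow_apply, wedgePow_apply]
  simp only [altSum]
  congr 1
  refine Finset.sum_congr rfl fun s _ => ?_
  congr 1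
  refine Finset.prod_congr rfl fun i _ => ?_
  exact congrArg (θ _) (by ext j; fin_cases j <;> rfl)

end HyperHermitian

/-! ### Forms and connection on the total space -/

section TotalSpace

variable {E : Type*} [NormedAddCommGroup E] [NormedSpace ℝ E]
  {E' : Type*} [NormedAddCommGroup E'] [NormedSpace ℝ E']
  {M : Type*} [TopologicalSpace M] [ChartedSpace E M]
  {P : Type*} [TopologicalSpace P] [ChartedSpace E' P]
  {π : P → M} {ν : Fin 4 → DForm E' P 1 ℝ} {p : P}

/-- The combination of the two-forms on the fibre. -/
def combFibreForm (a b c : ℝ) : (Fin 4 → ℝ) [⋀^Fin 2]→L[ℝ] ℝ :=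
  a • fibreForm 0 + b • fibreForm 1 + c • fibreForm 2

theorem combFibreForm_apply (a b c : ℝ) (x y : Fin 4 → ℝ) :
    combFibreForm a b c ![x, y] = ∑ j, quatComb quatMul a b c x j * y j := by
  have e : combFibreForm a b c ![x, y]
      = a * fibreForm 0 ![x, y] + b * fibreForm 1 ![x, y] + c * fibreForm 2 ![x, y] := rfl
  rw [e]
  simp only [fibreForm_apply, quatComb, add_apply, smul_apply, Pi.add_apply, Pi.smul_apply,
    smul_eq_mul, Fin.sum_univ_four]
  ring

theorem checkForm_apply (σ : Fin 3 → DForm E M 2 ℝ) (i : Fin 3) (v w : TangentSpace 𝓘(ℝ, E') p) :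
    checkForm π σ ν i p ![v, w]
      = σ i (π p) ![(splitting E π ν p v).1, (splitting E π ν p w).1]
        + fibreForm i ![(splitting E π ν p v).2, (splitting E π ν p w).2] := by
  have hpb : ∀ i, (σ i).pullback π p ![v, w]
      = σ i (π p) ![(splitting E π ν p v).1, (splitting E π ν p w).1] := fun i =>
    congrArg (σ i (π p)) (by ext j; fin_cases j <;> rfl)
  have hw : ∀ i j, (ν i).wedge (ν j) p ![v, w]
      = wedge (coordForm i) (coordForm j) ![(splitting E π ν p v).2, (splitting E π ν p w).2] := by
    intro i j
    rw [DForm.wedge, wedge_one_one_apply, wedge_one_one_apply]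
    simp only [coordForm_apply]
    change _ = connMap ν p v i * connMap ν p w j - connMap ν p w i * connMap ν p v j
    simp only [connMap_apply]
  rw [← hpb]
  fin_cases i
  · change (σ 0).pullback π p ![v, w] + (ν 0).wedge (ν 1) p ![v, w] + (ν 2).wedge (ν 3) p ![v, w]
      = _
    rw [hw, hw, add_assoc]
    rfl
  · change (σ 1).pullback π p ![v, w] + (ν 0).wedge (ν 2) p ![v, w] + (ν 3).wedge (ν 1) p ![v, w]
      = _
    rw [hw, hw, add_assoc]
    rfl
  · change (σ 2).pullback π p ![v, w] + (ν 0).wedge (ν 3) p ![v, w] + (ν 1).wedge (ν 2) p ![v, w]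
      = _
    rw [hw, hw, add_assoc]
    rfl

theorem combForm_checkForm_apply (σ : Fin 3 → DForm E M 2 ℝ) (a b c : ℝ)
    (v w : TangentSpace 𝓘(ℝ, E') p) :
    combForm (checkForm π σ ν) a b c p ![v, w]
      = combForm σ a b c (π p) ![(splitting E π ν p v).1, (splitting E π ν p w).1]
        + combFibreForm a b c ![(splitting E π ν p v).2, (splitting E π ν p w).2] := by
  have e : ∀ x y, combFibreForm a b c ![x, y] = a * fibreForm 0 ![x, y]
      + b * fibreForm 1 ![x, y] + c * fibreForm 2 ![x, y] := fun _ _ => rfl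
  rw [combForm_vec_apply, combForm_vec_apply, e, checkForm_apply, checkForm_apply, checkForm_apply]
  ring

theorem splitting_combJ (hΦ : ∀ p, (splitting E π ν p).IsInvertible) (I : Fin 3 → EndField E M)
    (a b c : ℝ) (p : P) (v : TangentSpace 𝓘(ℝ, E') p) :
    splitting E π ν p (combJ (fun i => liftField π ν (I i) (quatMul i)) a b c p v)
      = (combJ I a b c (π p) (splitting E π ν p v).1,
        quatComb quatMul a b c (splitting E π ν p v).2) :=
  map_quatComb_liftEnd (hΦ p) (fun i => I i (π p)) quatMul a b c v

variable [IsManifold 𝓘(ℝ, E') ∞ P]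

theorem fderiv_connInChart [FiniteDimensional ℝ E'] (hν : ∀ i, (ν i).IsSmooth) (v w : E') :
    fderiv ℝ (connInChart ν p) (chartAt E' p p) v w
      - fderiv ℝ (connInChart ν p) (chartAt E' p p) w v
      = fun i => (ν i).d.inChart p (chartAt E' p p) ![v, w] := by
  have hN := (contDiffAt_connInChart hν p).differentiableAt (by simp)
  have hd : ∀ i v w, fderiv ℝ (connInChart ν p) (chartAt E' p p) v w i
      = fderiv ℝ ((ν i).inChart p) (chartAt E' p p) v ![w] := by
    intro i v w
    have hνi : DifferentiableAt ℝ ((ν i).inChart p) (chartAt E' p p) :=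
      ((hν i p).contDiffAt (chart_target_mem_nhds p)).differentiableAt (by simp)
    have h := fderiv_oneForm_apply hνi (differentiableAt_const w) v
    have hz : ∀ q, (ν i).inChart p q ![(0 : E')] = 0 := fun q =>
      ((ν i).inChart p q).map_coord_zero 0 rfl
    have hNw : DifferentiableAt ℝ (fun q => connInChart ν p q w) (chartAt E' p p) :=
      hN.clm_apply (differentiableAt_const w)
    simp only [← connInChart_apply] at h
    rw [fderiv_apply hNw i, ContinuousLinearMap.comp_apply, fderiv_clm_apply_const hN] at h
    simpa [connInChart_apply, hz] using h
  ext i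
  rw [DForm.d_inChart, extDeriv_oneForm_apply, Pi.sub_apply, hd, hd]

end TotalSpace

/-! ### The Hermitian and balanced structures on P -/

section Balanced

variable {E : Type*} [NormedAddCommGroup E] [NormedSpace ℝ E]
  {E' : Type*} [NormedAddCommGroup E'] [NormedSpace ℝ E']
  {M : Type*} [TopologicalSpace M] [ChartedSpace E M] [IsManifold 𝓘(ℝ, E) ∞ M]
  {P : Type*} [TopologicalSpace P] [ChartedSpace E' P] [IsManifold 𝓘(ℝ, E') ∞ P]
  {π : P → M} {ν : Fin 4 → DForm E' P 1 ℝ} {p : P} {q : E'}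

/-- The almost complex structures on the total space. -/
def checkJ (π : P → M) (ν : Fin 4 → DForm E' P 1 ℝ) (I : Fin 3 → EndField E M) :
    Fin 3 → EndField E' P :=
  fun i => liftField π ν (I i) (quatMul i)

/-- The derivative of `π` in terms of the preferred chart at `p`. -/
def projInChart (E : Type*) [NormedAddCommGroup E] [NormedSpace ℝ E] [ChartedSpace E M]
    (π : P → M) (p : P) (q : E') :
    E' →L[ℝ] TangentSpace 𝓘(ℝ, E) (π ((chartAt E' p).symm q)) :=
  mfderiv 𝓘(ℝ, E') 𝓘(ℝ, E) π ((chartAt E' p).symm q) ∘L fromChart p q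

omit [IsManifold 𝓘(ℝ, E) ∞ M] [IsManifold 𝓘(ℝ, E') ∞ P] in
theorem splitting_fromChart (v : E') :
    splitting E π ν ((chartAt E' p).symm q) (fromChart p q v)
      = (projInChart E π p q v, connInChart ν p q v) := rfl

omit [IsManifold 𝓘(ℝ, E) ∞ M] [IsManifold 𝓘(ℝ, E') ∞ P] in
theorem pullback_inChart_two (θ : DForm E M 2 ℝ) (v w : E') :
    (θ.pullback π : DForm E' P 2 ℝ).inChart p q ![v, w]
      = θ (π ((chartAt E' p).symm q)) ![projInChart E π p q v, projInChart E π p q w] :=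
  congrArg (θ _) (by ext j; fin_cases j <;> rfl)

omit [IsManifold 𝓘(ℝ, E) ∞ M] in
theorem splitting_combJ_inChart (hΦ : ∀ p, (splitting E π ν p).IsInvertible)
    (I : Fin 3 → EndField E M) (a b c : ℝ) (hq : q ∈ (chartAt E' p).target) (v : E') :
    projInChart E π p q ((combJ (checkJ π ν I) a b c).inChart p q v)
        = combJ I a b c _ (projInChart E π p q v) ∧
      connInChart ν p q ((combJ (checkJ π ν I) a b c).inChart p q v)
        = quatComb quatMul a b c (connInChart ν p q v) := by
  have h := splitting_combJ hΦ I a b c _ (fromChart p q v)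
  change splitting E π ν _ (combJ (checkJ π ν I) a b c _ _) = _ at h
  rw [← EndField.fromChart_inChart _ hq, splitting_fromChart, splitting_fromChart,
    Prod.mk.injEq] at h
  exact h

-- The curvature sees horizontal components only; hence dν inherits invariance under J from the γ_i
-- on M.
omit [IsManifold 𝓘(ℝ, E) ∞ M] in
theorem curvature_inChart [FiniteDimensional ℝ E'] (hν : ∀ i, (ν i).IsSmooth)
    {γ : Fin 4 → DForm E M 2 ℝ} (hdν : ∀ i, (ν i).d = (γ i).pullback π) (v w : E') :
    fderiv ℝ (connInChart ν p) (chartAt E' p p) v w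
      - fderiv ℝ (connInChart ν p) (chartAt E' p p) w v
      = fun i => γ i (π ((chartAt E' p).symm (chartAt E' p p)))
          ![projInChart E π p (chartAt E' p p) v, projInChart E π p (chartAt E' p p) w] := by
  rw [fderiv_connInChart hν]
  ext i
  rw [hdν, pullback_inChart_two]

variable {g : Metric E M} {I : Fin 3 → EndField E M} {σ : Fin 3 → DForm E M 2 ℝ}
  {γ : Fin 4 → DForm E M 2 ℝ} {a b c : ℝ} [FiniteDimensional ℝ E] [FiniteDimensional ℝ E']

omit [IsManifold 𝓘(ℝ, E') ∞ P] [FiniteDimensional ℝ E] [FiniteDimensional ℝ E'] in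
theorem combJ_checkJ_sq (hM : IsHyperHermitian g I σ)
    (hΦ : ∀ p, (splitting E π ν p).IsInvertible) (habc : a ^ 2 + b ^ 2 + c ^ 2 = 1) (p : P)
    (v : TangentSpace 𝓘(ℝ, E') p) :
    combJ (checkJ π ν I) a b c p (combJ (checkJ π ν I) a b c p v) = -v := by
  apply (hΦ p).injective
  have h := splitting_combJ hΦ I a b c p
  change ∀ v, splitting E π ν p (combJ (checkJ π ν I) a b c p v) = _ at h
  rw [h, h, map_neg, hM.combJ_sq habc, isQuaternionic_quatMul.comb_sq habc]
  rfl

theorem contDiffAt_combJ_checkJ (hM : IsHyperHermitian g I σ)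
    (hE : Module.finrank ℝ E' = Module.finrank ℝ E + 4)
    (hπ : ContMDiff 𝓘(ℝ, E') 𝓘(ℝ, E) ∞ π) (hν : ∀ i, (ν i).IsSmooth)
    (hΦ : ∀ p, (splitting E π ν p).IsInvertible) (a b c : ℝ) (p : P) :
    ContDiffAt ℝ ∞ ((combJ (checkJ π ν I) a b c).inChart p) (chartAt E' p p) :=
  contDiffAt_lift_inChart hE hπ hν hΦ (splitting_combJ hΦ I a b c) p
    (hM.contDiffAt_combJ_inChart a b c (π p))

/-- Apply `nijenhuis_eq_zero` with s and t the pullbacks of σ_{u'} and σ_{u × u'}, where u' is a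
unit vector orthogonal to u, and N the connection. -/
theorem isIntegrable_combJ_checkJ (hM : IsHyperKahler g I σ)
    (hE : Module.finrank ℝ E' = Module.finrank ℝ E + 4)
    (hπ : ContMDiff 𝓘(ℝ, E') 𝓘(ℝ, E) ∞ π) (hν : ∀ i, (ν i).IsSmooth)
    (hΦ : ∀ p, (splitting E π ν p).IsInvertible) (hγ : ∀ i, IsSpForm I (γ i))
    (hdν : ∀ i, (ν i).d = (γ i).pullback π) (habc : a ^ 2 + b ^ 2 + c ^ 2 = 1) :
    IsIntegrable (combJ (checkJ π ν I) a b c) := by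
  have hH := hM.hyperHermitian
  refine isIntegrable_of_nijenhuis_eq_zero (contDiffAt_combJ_checkJ hH hE hπ hν hΦ a b c)
    (combJ_checkJ_sq hH hΦ habc) fun p v w => ?_
  obtain ⟨a', b', c', h', ho⟩ := exists_orthogonal_unit a b c
  have hp := mem_chart_target E' p
  have hJ := fun q (hq : q ∈ (chartAt E' p).target) => splitting_combJ_inChart hΦ I a b c hq
  refine nijenhuis_eq_zero (K := quatComb quatMul a b c) (N := connInChart ν p)
    (s := (DForm.pullback π (combForm σ a' b' c') : DForm E' P 2 ℝ).inChart p)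
    (t := (DForm.pullback π (combForm σ (b * c' - c * b') (c * a' - a * c') (a * b' - b * a')) :
      DForm E' P 2 ℝ).inChart p)
    ((contDiffAt_combJ_checkJ hH hE hπ hν hΦ a b c p).differentiableAt (by simp))
    (differentiableAt_pullback_inChart hπ (hH.differentiableAt_combForm_inChart _ _ _ _))
    (differentiableAt_pullback_inChart hπ (hH.differentiableAt_combForm_inChart _ _ _ _))
    ((contDiffAt_connInChart hν p).differentiableAt (by simp)) ?_ ?_ ?_ ?_
    (extDeriv_pullback_inChart_eq_zero hπ (hH.differentiableAt_combForm_inChart _ _ _ _)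
      (hM.extDeriv_combForm _ _ _ _))
    (extDeriv_pullback_inChart_eq_zero hπ (hH.differentiableAt_combForm_inChart _ _ _ _)
      (hM.extDeriv_combForm _ _ _ _)) ?_ (isQuaternionic_quatMul.comb_sq habc) ?_ v w
  · intro v
    obtain ⟨v, rfl⟩ := toChart_surjective (mem_chart_source E' p) v
    rw [EndField.inChart_toChart _ (mem_chart_source E' p),
      EndField.inChart_toChart _ (mem_chart_source E' p), combJ_checkJ_sq hH hΦ habc, map_neg]
  · filter_upwards [chart_target_mem_nhds p] with q hq v w
    rw [pullback_inChart_two, pullback_inChart_two, (hJ q hq v).1, hH.combForm_combJ,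
      hH.combForm_apply, hH.combForm_apply]
    have e : a' * a + b' * b + c' * c = 0 := by linear_combination ho
    rw [e, neg_zero, zero_mul, zero_add, ← neg_apply, ← map_neg]
    congr 2
    simp only [combJ, add_apply, smul_apply]
    module
  · filter_upwards [chart_target_mem_nhds p] with q hq v w
    rw [pullback_inChart_two, pullback_inChart_two, (hJ q hq v).1, hH.combForm_combJ]
    -- Triple products: (u × u') · u = 0 and (u × u') × u = u'.
    have e : (b * c' - c * b') * a + (c * a' - a * c') * b + (a * b' - b * a') * c = 0 := by ring
    have e₁ : (c * a' - a * c') * c - (a * b' - b * a') * b = a' := by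
      linear_combination a' * habc - a * ho
    have e₂ : (a * b' - b * a') * a - (b * c' - c * b') * c = b' := by
      linear_combination b' * habc - b * ho
    have e₃ : (b * c' - c * b') * b - (c * a' - a * c') * a = c' := by
      linear_combination c' * habc - c * ho
    rw [e, e₁, e₂, e₃, neg_zero, zero_mul, zero_add]
  · filter_upwards [chart_target_mem_nhds p] with q hq v using (hJ q hq v).2
  · intro v w
    rw [curvature_inChart hν hdν, curvature_inChart hν hdν]
    ext i
    rw [(hJ _ hp v).1, (hJ _ hp w).1]
    exact hγ i a b c habc _ _ _
  · intro x hs hN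
    set y := (chartAt E' p).symm (chartAt E' p p)
    -- The test vector is the horizontal lift of J_{u'} applied to the horizontal part of x; s on x
    -- and this vector is the squared length of that part.
    obtain ⟨u, hu⟩ := (hΦ y).surjective
      (combJ I a' b' c' (π y) (projInChart E π p (chartAt E' p p) x), 0)
    have hu' : projInChart E π p (chartAt E' p p) (toChart p y u)
        = combJ I a' b' c' (π y) (projInChart E π p (chartAt E' p p) x) := by
      have h := splitting_fromChart (E := E) (π := π) (ν := ν) (p := p) (q := chartAt E' p p)
        (toChart p y u)
      rw [fromChart_toChart hp, hu] at h
      exact (congrArg Prod.fst h).symm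
    have h1 := hs (toChart p y u)
    rw [pullback_inChart_two, hH.combForm_apply, hu', hH.combJ_isometry h'] at h1
    have h2 : projInChart E π p (chartAt E' p p) x = 0 := by
      by_contra h0
      exact (g.pos _ _ h0).ne' h1
    have h3 : fromChart p (chartAt E' p p) x = 0 := by
      apply (hΦ y).injective
      rw [splitting_fromChart, h2, hN, map_zero]
      rfl
    rw [← toChart_fromChart hp x, h3, map_zero]

theorem isHermitian_combJ_checkJ (hM : IsHyperKahler g I σ)
    (hE : Module.finrank ℝ E' = Module.finrank ℝ E + 4)
    (hπ : ContMDiff 𝓘(ℝ, E') 𝓘(ℝ, E) ∞ π) (hν : ∀ i, (ν i).IsSmooth)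
    (hΦ : ∀ p, (splitting E π ν p).IsInvertible) (hγ : ∀ i, IsSpForm I (γ i))
    (hdν : ∀ i, (ν i).d = (γ i).pullback π) (habc : a ^ 2 + b ^ 2 + c ^ 2 = 1) :
    IsHermitian (checkMetric g hπ hν hΦ) (combJ (checkJ π ν I) a b c)
      (combForm (checkForm π σ ν) a b c) := by
  have hH := hM.hyperHermitian
  have hJ : ∀ p v, splitting E π ν p (combJ (checkJ π ν I) a b c p v) = _ :=
    splitting_combJ hΦ I a b c
  refine ⟨⟨fun p => (contMDiffAt_endField_iff _ p).2 (contDiffAt_combJ_checkJ hH hE hπ hν hΦ a b c p),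
    combJ_checkJ_sq hH hΦ habc, isIntegrable_combJ_checkJ hM hE hπ hν hΦ hγ hdν habc⟩, ?_, ?_⟩
  · intro p v w
    change checkInner g π ν p _ _ = checkInner g π ν p v w
    rw [checkInner_apply, checkInner_apply, hJ, hJ, hH.combJ_isometry habc]
    congr 1
    -- The Euclidean product as a bilinear map, so that `IsQuaternionic.comb_isometry` also covers
    -- the fibre.
    let B : (Fin 4 → ℝ) →L[ℝ] (Fin 4 → ℝ) →L[ℝ] ℝ :=
      ∑ i, (ContinuousLinearMap.proj i).smulRight (ContinuousLinearMap.proj i)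
    have hB : ∀ x y, B x y = ∑ i, x i * y i := fun x y => by simp [B]
    rw [← hB, ← hB]
    exact isQuaternionic_quatMul.comb_isometry
      (fun i x y => by rw [hB, hB, quatMul_isometry]) habc _ _
  · intro p v w
    change _ = checkInner g π ν p _ _
    rw [checkInner_apply, hJ, combForm_checkForm_apply, hH.combForm_apply, combFibreForm_apply]

theorem isHyperHermitian_checkJ (hM : IsHyperKahler g I σ)
    (hE : Module.finrank ℝ E' = Module.finrank ℝ E + 4)
    (hπ : ContMDiff 𝓘(ℝ, E') 𝓘(ℝ, E) ∞ π) (hν : ∀ i, (ν i).IsSmooth)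
    (hΦ : ∀ p, (splitting E π ν p).IsInvertible) (hγ : ∀ i, IsSpForm I (γ i))
    (hdν : ∀ i, (ν i).d = (γ i).pullback π) :
    IsHyperHermitian (checkMetric g hπ hν hΦ) (checkJ π ν I) (checkForm π σ ν) where
  hermitian i := by
    -- Each Ǐ_i is the combination for a standard basis vector, so the Hermitian property of
    -- combinations covers it.
    have hJ : ∀ i, ∃ a b c : ℝ, a ^ 2 + b ^ 2 + c ^ 2 = 1 ∧ combJ (checkJ π ν I) a b c
        = checkJ π ν I i ∧ combForm (checkForm π σ ν) a b c = checkForm π σ ν i := by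
      intro i
      fin_cases i
      · refine ⟨1, 0, 0, by norm_num, ?_, ?_⟩ <;> ext x v <;>
          simp [combJ_apply, combForm_vec_apply]
      · refine ⟨0, 1, 0, by norm_num, ?_, ?_⟩ <;> ext x v <;>
          simp [combJ_apply, combForm_vec_apply]
      · refine ⟨0, 0, 1, by norm_num, ?_, ?_⟩ <;> ext x v <;>
          simp [combJ_apply, combForm_vec_apply]
    obtain ⟨a, b, c, habc, h₁, h₂⟩ := hJ i
    rw [← h₁, ← h₂]
    exact isHermitian_combJ_checkJ hM hE hπ hν hΦ hγ hdν habc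
  mul_eq i p := (IsQuaternionic.liftEnd (hΦ p) (hM.hyperHermitian.isQuaternionic (π p))
    isQuaternionic_quatMul).mul_eq i
  anticomm i p := (IsQuaternionic.liftEnd (hΦ p) (hM.hyperHermitian.isQuaternionic (π p))
    isQuaternionic_quatMul).anticomm i

theorem isBalanced_combJ_checkJ {n : ℕ} (hn : Module.finrank ℝ E = 4 * n)
    (hM : IsHyperKahler g I σ)
    (hE : Module.finrank ℝ E' = Module.finrank ℝ E + 4)
    (hπ : ContMDiff 𝓘(ℝ, E') 𝓘(ℝ, E) ∞ π) (hν : ∀ i, (ν i).IsSmooth)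
    (hΦ : ∀ p, (splitting E π ν p).IsInvertible) (hγ : ∀ i, IsSpForm I (γ i))
    (hdν : ∀ i, (ν i).d = (γ i).pullback π) (habc : a ^ 2 + b ^ 2 + c ^ 2 = 1) :
    IsBalanced (2 * n + 2) (checkMetric g hπ hν hΦ) (combJ (checkJ π ν I) a b c)
      (combForm (checkForm π σ ν) a b c) where
  dim := by omega
  hermitian := isHermitian_combJ_checkJ hM hE hπ hν hΦ hγ hdν habc
  coclosed := by
    have hH := hM.hyperHermitian
    -- The exponent m - 1 with m = 2n + 2.
    change ((combForm (checkForm π σ ν) a b c).pow (2 * n + 1)).d = 0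
    refine DForm.d_eq_zero_of_extDeriv fun p => ?_
    have hpow : ((combForm (checkForm π σ ν) a b c).pow (2 * n + 1)).inChart p
        = fun q => wedgePow ((combForm (checkForm π σ ν) a b c).inChart p q) (2 * n + 1) :=
      funext fun q => DForm.pow_inChart _ _ p q
    -- J_{u'} with u' orthogonal to u serves as R: it preserves every γ_i and reverses σ_u.
    obtain ⟨a', b', c', h', ho⟩ := exists_orthogonal_unit a b c
    set y := (chartAt E' p).symm (chartAt E' p p)
    rw [hpow]
    refine extDeriv_wedgePow_eq_zero (H := E) (U := Fin 4 → ℝ) hn (by simp)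
      (projInChart E π p (chartAt E' p p)) (combFibreForm a b c) (combForm σ a b c (π y))
      (fun i => γ i (π y)) (fun i => Pi.single i 1) (combJ I a' b' c' (π y))
      (s := (DForm.pullback π (combForm σ a b c) : DForm E' P 2 ℝ).inChart p)
      (N := connInChart ν p)
      (differentiableAt_pullback_inChart hπ (hH.differentiableAt_combForm_inChart _ _ _ _))
      ((contDiffAt_connInChart hν p).differentiableAt (by simp)) (.of_forall fun q v w => ?_)
      (extDeriv_pullback_inChart_eq_zero hπ (hH.differentiableAt_combForm_inChart _ _ _ _)
        (hM.extDeriv_combForm _ _ _ _)) (fun v w => pullback_inChart_two _ v w) (fun v w => ?_)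
      (hH.combJ_sq h' (π y)) (fun i => hγ i a' b' c' h' (π y)) ?_
    · have h := combForm_checkForm_apply (π := π) (ν := ν) σ a b c (fromChart p q v)
        (fromChart p q w)
      rw [splitting_fromChart, splitting_fromChart] at h
      rw [pullback_inChart_two]
      refine Eq.trans ?_ h
      exact congrArg (combForm (checkForm π σ ν) a b c _) (by ext j; fin_cases j <;> rfl)
    · rw [curvature_inChart hν hdν]
      ext i
      simp [Finset.sum_apply, Pi.single_apply, y]
      rfl
    · exact hH.combForm_combJ_combJ h' ho (π y)

end Balanced

end BalancedTorusBundle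

end

/-! ### The theorem -/

open BalancedTorusBundle in
theorem mainTheorem8 (n : ℕ)
    -- the hyperkähler manifold `M` of real dimension `4n`
    {M : Type*} [TopologicalSpace M] [T2Space M] [SecondCountableTopology M]
    [ChartedSpace (EuclideanSpace ℝ (Fin (4 * n))) M]
    [IsManifold 𝓘(ℝ, EuclideanSpace ℝ (Fin (4 * n))) ∞ M]
    (g : Metric (EuclideanSpace ℝ (Fin (4 * n))) M)
    (I : Fin 3 → EndField (EuclideanSpace ℝ (Fin (4 * n))) M)
    (σ : Fin 3 → DForm (EuclideanSpace ℝ (Fin (4 * n))) M 2 ℝ)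
    (hM : IsHyperKahler g I σ)
    -- the closed 2-forms `γ₁, …, γ₄ ∈ 𝔰𝔭(n)`
    (γ : Fin 4 → DForm (EuclideanSpace ℝ (Fin (4 * n))) M 2 ℝ)
    (hγ_smooth : ∀ i, (γ i).IsSmooth)
    (hγ_closed : ∀ i, (γ i).d = 0)
    (hγ_sp : ∀ i, IsSpForm I (γ i))
    -- the principal `𝕋⁴`-bundle `P → M` with connection forms `νᵢ` of curvature `γᵢ`
    {P : Type*} [TopologicalSpace P] [T2Space P] [SecondCountableTopology P]
    [ChartedSpace (EuclideanSpace ℝ (Fin (4 * n + 4))) P]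
    [IsManifold 𝓘(ℝ, EuclideanSpace ℝ (Fin (4 * n + 4))) ∞ P]
    [MulAction T4 P] (π : P → M)
    (hπ : IsPrincipalT4Bundle (E := EuclideanSpace ℝ (Fin (4 * n)))
      (E' := EuclideanSpace ℝ (Fin (4 * n + 4))) π)
    (ν : Fin 4 → DForm (EuclideanSpace ℝ (Fin (4 * n + 4))) P 1 ℝ)
    (hν : IsConnection ν)
    (hdν : ∀ i, (ν i).d = (γ i).pullback π) :
    ∃ (G : Metric (EuclideanSpace ℝ (Fin (4 * n + 4))) P)
      (J : Fin 3 → EndField (EuclideanSpace ℝ (Fin (4 * n + 4))) P),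
      IsCheckMetric π g ν G ∧
      IsHyperHermitian G J (checkForm π σ ν) ∧
      ∀ a b c : ℝ, a ^ 2 + b ^ 2 + c ^ 2 = 1 →
        IsBalanced (2 * n + 2) G (combJ J a b c) (combForm (checkForm π σ ν) a b c) := by
  have hE : Module.finrank ℝ (EuclideanSpace ℝ (Fin (4 * n + 4)))
      = Module.finrank ℝ (EuclideanSpace ℝ (Fin (4 * n))) + 4 := by simp
  have hΦ := hπ.splitting_isInvertible hE hν
  exact ⟨checkMetric g hπ.smooth_proj hν.smooth hΦ, checkJ π ν I,
    checkMetric_isCheckMetric g hπ.smooth_proj hν.smooth hΦ,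
    isHyperHermitian_checkJ hM hE hπ.smooth_proj hν.smooth hΦ hγ_sp hdν,
    fun _ _ _ habc => isBalanced_combJ_checkJ (by simp) hM hE hπ.smooth_proj hν.smooth hΦ
      hγ_sp hdν habc⟩
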